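/- Let $\Omega\subset\mathbb R^N$ ($N\ge 1$) be a bounded open set. For $p>N$ let $\lambda_p$ be the first (smallest) eigenvalue of the $p$-Laplacian on $W^{1,p}_0(\Omega)$, i.e. the smallest $\lambda$ for which $-\mathrm{div}(|\nabla u|^{p-2}\nabla u)=\lambda|u|^{p-2}u$ has a non-zero distributional solution $u\in W^{1,p}_0(\Omega)$, and let $u_p$ be a corresponding eigenfunction which is positive in $\Omega$ with $\int_\Omega u_p^p\,dx=1$. Let $\Lambda_\infty\in\mathbb R$ and a finite positive Borel measure $f_\infty$ on $\overline\Omega$ be limits along some sequence of exponents $p\to\infty$: $\lambda_p^{1/p}\to\Lambda_\infty$ and $u_p^{p-1}\,dx\to f_\infty$ weakly-$*$ in the measures on $\overline\Omega$. Consider $$(\mathcal P_\infty)\qquad \min\Big\{-\int_{\overline\Omega} u\,df_\infty:\ u\in\mathrm{Lip}(\Omega),\ |\nabla u|\le\Lambda_\infty\ \text{a.e. in }\Omega,\ u=0\text{ on }\partial\Omega\Big\},$$ $$(\mathcal P_\infty^*)\qquad \min_{\lambda\in\mathcal P(\partial\Omega)}\ \min_{\sigma\in\mathcal M_b(\mathbb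 R^N)^N}\Big\{\Lambda_\infty\int_{\mathbb R^N}|\sigma|:\ -\mathrm{div}\,\sigma=f_\infty-\lambda\ \text{in }\mathbb R^N\Big\},$$ where $\mathcal P(\partial\Omega)$ is the set of Borel probability measures on $\partial\Omega$, $\mathcal M_b(\mathbb R^N)^N$ is the set of bounded $\mathbb R^N$-valued Borel measures, $|\sigma|$ is the total variation measure of $\sigma$ for the Euclidean norm, and $-\mathrm{div}\,\sigma=f_\infty-\lambda$ in $\mathbb R^N$ means $\int\nabla\varphi\cdot d\sigma=\int\varphi\,d(f_\infty-\lambda)$ for all $\varphi\in C_c^\infty(\mathbb R^N)$. Then all these minima are attained (the inner one for every $\lambda\in\mathcal P(\partial\Omega)$), and $$\min(\mathcal P_\infty)=-\min(\mathcal P_\infty^*).$$ Moreover $$\min(\mathcal P_\infty^*)=\min_{\sigma\in\mathcal M_b(\mathbb R^N)^N}\Big\{\Lambda_\infty\int_{\overline\Omega}|\sigma|:\ \mathrm{spt}(\sigma)\subset\overline\Omega,\ -\mathrm{div}\,\sigma\in\mathcal M_b(\mathbb R^N),\ -\mathrm{div}\,\sigma=f_\infty\ \text{in }\Omega\Big\},$$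 the last minimum being attained too, where $-\mathrm{div}\,\sigma\in\mathcal M_b(\mathbb R^N)$ means that the distributional divergence of $\sigma$ on $\mathbb R^N$ is a bounded signed measure, and $-\mathrm{div}\,\sigma=f_\infty$ in $\Omega$ means $\int\nabla\varphi\cdot d\sigma=\int\varphi\,df_\infty$ for all $\varphi\in C_c^\infty(\Omega)$. -/

import Mathlib

open MeasureTheory Filter Topology TopologicalSpace
open scoped Distributions RealInnerProductSpace Gradient BoundedContinuousFunction

noncomputable section

/-- The Euclidean space `ℝ^N`. -/
abbrev RN (N : ℕ) : Type := EuclideanSpace ℝ (Fin N)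

/-! ### The first eigenvalue of the `p`-Laplacian -/

/-- `G` is the weak gradient of `u` on `Ω`. -/
def IsWeakGradient {N : ℕ} (Ω : Opens (RN N)) (u : RN N → ℝ) (G : RN N → RN N) : Prop :=
  ∀ φ : 𝓓(Ω, ℝ), ∫ x in (Ω : Set (RN N)), u x • ∇ (φ : RN N → ℝ) x =
    - ∫ x in (Ω : Set (RN N)), φ x • G x

/-- `u ∈ W₀^{1,p}(Ω)` with weak gradient `G`: both are in `L^p(Ω)` and `u` is the limit in the
`W^{1,p}` norm of a sequence of test functions on `Ω`. -/
structure MemW01p {N : ℕ} (p : ℝ) (Ω : Opens (RN N)) (u : RN N → ℝ) (G : RN N → RN N) :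
    Prop where
  memLp : MemLp u (ENNReal.ofReal p) (volume.restrict (Ω : Set (RN N)))
  memLp_grad : MemLp G (ENNReal.ofReal p) (volume.restrict (Ω : Set (RN N)))
  isWeakGradient : IsWeakGradient Ω u G
  approx : ∃ φ : ℕ → 𝓓(Ω, ℝ),
    Tendsto (fun k => eLpNorm (fun x => φ k x - u x) (ENNReal.ofReal p)
      (volume.restrict (Ω : Set (RN N)))) atTop (𝓝 0) ∧
    Tendsto (fun k => eLpNorm (fun x => ∇ (φ k : RN N → ℝ) x - G x) (ENNReal.ofReal p)
      (volume.restrict (Ω : Set (RN N)))) atTop (𝓝 0)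

/-- `u ∈ W₀^{1,p}(Ω)` solves `-div (|∇u|^{p-2} ∇u) = lam |u|^{p-2} u` in the sense of
distributions in `Ω`. -/
def IsPLaplaceSolution {N : ℕ} (p : ℝ) (Ω : Opens (RN N)) (lam : ℝ) (u : RN N → ℝ) : Prop :=
  ∃ G : RN N → RN N, MemW01p p Ω u G ∧
    ∀ φ : 𝓓(Ω, ℝ),
      ∫ x in (Ω : Set (RN N)), ‖G x‖ ^ (p - 2) * ⟪G x, ∇ (φ : RN N → ℝ) x⟫ =
        lam * ∫ x in (Ω : Set (RN N)), |u x| ^ (p - 2) * u x * φ x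

/-- `lam` is an eigenvalue of the `p`-Laplacian: there is a non-zero solution. -/
def IsPLaplaceEigenvalue {N : ℕ} (p : ℝ) (Ω : Opens (RN N)) (lam : ℝ) : Prop :=
  ∃ u : RN N → ℝ, IsPLaplaceSolution p Ω lam u ∧
    ¬ (u =ᵐ[volume.restrict (Ω : Set (RN N))] 0)

/-- `lam` is the first, that is the smallest, eigenvalue of the `p`-Laplacian. -/
def IsFirstEigenvalue {N : ℕ} (p : ℝ) (Ω : Opens (RN N)) (lam : ℝ) : Prop :=
  IsLeast {l : ℝ | IsPLaplaceEigenvalue p Ω l} lam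

/-- `lam` is the first eigenvalue and `u` is a corresponding eigenfunction which is positive in
`Ω` and normalized in `L^p(Ω)`. -/
structure IsFirstEigenpair {N : ℕ} (p : ℝ) (Ω : Opens (RN N)) (lam : ℝ) (u : RN N → ℝ) :
    Prop where
  isFirst : IsFirstEigenvalue p Ω lam
  isSolution : IsPLaplaceSolution p Ω lam u
  pos : ∀ᵐ x ∂(volume.restrict (Ω : Set (RN N))), 0 < u x
  normalized : ∫ x in (Ω : Set (RN N)), u x ^ p = 1

/-- `Λ` and `f` (a finite positive measure on the closure of `Ω`) are limits obtained from the first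
eigenvalues and eigenfunctions along some sequence of exponents `p n > N` tending to infinity:
`(lam n)^{1/p n} → Λ`, and `(u n)^{p n - 1} dx → f` weakly-* in the measures on the closure. -/
def IsLimitAsPToInfty {N : ℕ} (Ω : Opens (RN N)) (f : Measure (RN N)) (Λ : ℝ) : Prop :=
  IsFiniteMeasure f ∧ f (closure (Ω : Set (RN N)))ᶜ = 0 ∧
  ∃ (p lam : ℕ → ℝ) (u : ℕ → RN N → ℝ),
    (∀ n, (N : ℝ) < p n) ∧ Tendsto p atTop atTop ∧
    (∀ n, IsFirstEigenpair (p n) Ω (lam n) (u n)) ∧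
    Tendsto (fun n => lam n ^ (1 / p n)) atTop (𝓝 Λ) ∧
    ∀ ψ : RN N →ᵇ ℝ,
      Tendsto (fun n => ∫ x in (Ω : Set (RN N)), ψ x * u n x ^ (p n - 1)) atTop
        (𝓝 (∫ x, ψ x ∂f))

/-! ### The limit problem -/

/-- `u ∈ Lip(Ω)` (extended by continuity to the closure), `u = 0` on `∂Ω` and `|∇u| ≤ Λ` almost
everywhere in `Ω`. -/
structure IsPrimalAdmissible {N : ℕ} (Ω : Opens (RN N)) (Λ : ℝ) (u : RN N → ℝ) : Prop where
  lipschitz : ∃ K : NNReal, LipschitzOnWith K u (closure (Ω : Set (RN N)))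
  boundary : ∀ x ∈ frontier (Ω : Set (RN N)), u x = 0
  gradient_le : ∀ᵐ x ∂(volume.restrict (Ω : Set (RN N))),
    DifferentiableAt ℝ u x ∧ ‖∇ u x‖ ≤ Λ

/-- The values `-⟨f, u⟩` taken in the limit problem. -/
def primalValues {N : ℕ} (Ω : Opens (RN N)) (f : Measure (RN N)) (Λ : ℝ) : Set ℝ :=
  {m | ∃ u : RN N → ℝ, IsPrimalAdmissible Ω Λ u ∧
    m = - ∫ x in closure (Ω : Set (RN N)), u x ∂f}

/-! ### The dual problem -/

/-- The Euclidean inner product of `ℝ^N` as a bounded bilinear map. -/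
def euclideanPairing (N : ℕ) : RN N →L[ℝ] RN N →L[ℝ] ℝ := innerSL ℝ

/-- `∫ ∇φ · dσ`. -/
def gradPairing {N : ℕ} (σ : VectorMeasure (RN N) (RN N)) (φ : RN N → ℝ) : ℝ :=
  ∫ᵛ x, ∇ φ x ∂[euclideanPairing N; σ]

/-- `σ` is a bounded vector measure. -/
def IsBoundedVectorMeasure {N : ℕ} (σ : VectorMeasure (RN N) (RN N)) : Prop :=
  IsFiniteMeasure σ.variation

/-- `ν` is a probability measure on `∂Ω`. -/
def IsBoundaryProbability {N : ℕ} (Ω : Opens (RN N)) (ν : Measure (RN N)) : Prop :=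
  IsProbabilityMeasure ν ∧ ν (frontier (Ω : Set (RN N)))ᶜ = 0

/-- The values `Λ ∫_{ℝ^N} |σ|` over bounded vector measures `σ` with `-div σ = f - ν` in `ℝ^N`, in
the sense of distributions. -/
def dualValues {N : ℕ} (f : Measure (RN N)) (Λ : ℝ) (ν : Measure (RN N)) : Set ℝ :=
  {m | ∃ σ : VectorMeasure (RN N) (RN N), IsBoundedVectorMeasure σ ∧
    (∀ φ : 𝓓((⊤ : Opens (RN N)), ℝ), gradPairing σ φ = ∫ x, φ x ∂f - ∫ x, φ x ∂ν) ∧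
    m = Λ * σ.variation.real Set.univ}

/-- The values `min {Λ ∫ |σ| : -div σ = f - ν in ℝ^N}`, for `ν` a probability measure on `∂Ω`. -/
def dualMinima {N : ℕ} (Ω : Opens (RN N)) (f : Measure (RN N)) (Λ : ℝ) : Set ℝ :=
  {m | ∃ ν : Measure (RN N), IsBoundaryProbability Ω ν ∧ IsLeast (dualValues f Λ ν) m}

/-- The values `Λ ∫_{closure Ω} |σ|` over bounded vector measures `σ` which are supported in the
closure of `Ω`, whose distributional divergence on `ℝ^N` is a bounded measure, and which satisfy
`-div σ = f` in `Ω` in the sense of distributions. -/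
def dualSupportedValues {N : ℕ} (Ω : Opens (RN N)) (f : Measure (RN N)) (Λ : ℝ) : Set ℝ :=
  {m | ∃ σ : VectorMeasure (RN N) (RN N), IsBoundedVectorMeasure σ ∧
    σ.variation.support ⊆ closure (Ω : Set (RN N)) ∧
    (∃ τ : SignedMeasure (RN N), ∀ φ : 𝓓((⊤ : Opens (RN N)), ℝ),
      gradPairing σ φ = ∫ᵛ x, φ x ∂•τ) ∧
    (∀ φ : 𝓓(Ω, ℝ), gradPairing σ φ = ∫ x, φ x ∂f) ∧
    m = Λ * σ.variation.real (closure (Ω : Set (RN N)))}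

end

/-! Put `d x = dist(x, Ωᶜ)`. The common value `m` is `Λ ∫ d df`.

An admissible `u` is at most `Λ d`: the ball `B(x, d x)` lies in `Ω` and touches `∂Ω`, and the
gradient bound can be integrated along almost every segment of this ball. The function `Λ d` is
itself admissible, which settles the primal problem. Testing the divergence constraint with
mollifications of `(d - ε)⁺`, which are `1`-Lipschitz and compactly supported in `Ω`, shows that
every competitor `σ` of the dual problems has mass at least `∫ d df`.

Conversely `φ ≤ d sup ‖∇φ‖ + sup φ` on the closure of `Ω`, with the suprema taken over the closure
and over `∂Ω`. Since `f` has mass one, `∫ φ df` is therefore at most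
`(∫ d df) sup ‖∇φ‖ + sup φ⁺`, and the Hahn–Banach and Riesz theorems represent it as
`∫ ∇φ · dσ + ∫ φ dν` with `σ` of mass at most `∫ d df` carried by the closure, and `ν` a positive
measure on `∂Ω`. Here `σ` is obtained from a positive measure on pairs (point, direction). The
same argument on all of `ℝ^N`, without a boundary term, gives the inner minimum for a fixed `ν`: it
is `Λ` times the supremum of `∫ φ d(f - ν)` over `1`-Lipschitz test functions.

That `f` has mass one means `∫ u_p^(p-1) → 1`. Hölder's inequality gives the upper bound
`|Ω|^(1/p)`. For the lower bound, the Gagliardo–Nirenberg–Sobolev inequality in `L^κ` applied to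
`|u_p|^p` bounds `∫ u_p^(κp)` by `(C p λ_p^(1/p))^κ`, and interpolating `∫ u_p^p = 1` between the
exponents `p - 1` and `κp` gives `1 ≤ (∫ u_p^(p-1))^(κ-1) (C p λ_p^(1/p))^(κ/p)`, whose last factor
tends to `1`. -/

section NormedLattice

variable {M : Type*} [NormedAddCommGroup M] [Lattice M]

theorem norm_posPart_add_le [HasSolidNorm M] [IsOrderedAddMonoid M] (h k : M) :
    ‖(h + k)⁺‖ ≤ ‖h⁺‖ + ‖k⁺‖ := by
  have hle : (h + k)⁺ ≤ h⁺ + k⁺ :=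
    sup_le (add_le_add (le_posPart h) (le_posPart k))
      (add_nonneg (posPart_nonneg h) (posPart_nonneg k))
  exact (norm_le_norm_of_abs_le_abs (by
    rwa [abs_of_nonneg (posPart_nonneg _),
      abs_of_nonneg (add_nonneg (posPart_nonneg h) (posPart_nonneg k))])).trans (norm_add_le _ _)

theorem norm_posPart_smul_of_pos [NormedSpace ℝ M] [PosSMulMono ℝ M] {c : ℝ} (hc : 0 < c) (h : M) :
    ‖(c • h)⁺‖ = c * ‖h⁺‖ := by
  have hsmul : (c • h)⁺ = c • h⁺ := by
    have := (OrderIso.smulRight hc).map_sup h 0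
    simpa only [OrderIso.smulRight_apply, smul_zero, posPart_def] using this.symm
  rw [hsmul, norm_smul, Real.norm_of_nonneg hc.le]

end NormedLattice

theorem exists_linearMap_comp_eq_of_le_sublinear {V M : Type*} [AddCommGroup V] [Module ℝ V]
    [AddCommGroup M] [Module ℝ M] (J : V →ₗ[ℝ] M) (L : V →ₗ[ℝ] ℝ) (p : M → ℝ)
    (hsmul : ∀ c : ℝ, 0 < c → ∀ z, p (c • z) = c * p z) (hadd : ∀ z w, p (z + w) ≤ p z + p w)
    (hL : ∀ v, L v ≤ p (J v)) : ∃ T : M →ₗ[ℝ] ℝ, T ∘ₗ J = L ∧ ∀ z, T z ≤ p z := by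
  have hp0 : p 0 = 0 := by linarith [smul_zero (A := M) (2 : ℝ) ▸ hsmul 2 two_pos 0]
  have hker : L ∈ (LinearMap.ker J).dualAnnihilator := by
    refine (Submodule.mem_dualAnnihilator L).2 fun v (hv : J v = 0) => ?_
    have hle := hL v
    have hge := hL (-v)
    rw [map_neg, map_neg, hv, neg_zero, hp0] at hge
    rw [hv, hp0] at hle
    linarith
  rw [← LinearMap.range_dualMap_eq_dualAnnihilator_ker] at hker
  obtain ⟨F, rfl⟩ := hker
  obtain ⟨T, hTF, hTp⟩ := exists_extension_of_le_sublinear (F.toPMap (LinearMap.range J)) p hsmul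
    hadd (by rintro ⟨_, v, rfl⟩; exact hL v)
  exact ⟨T, LinearMap.ext fun v => hTF ⟨J v, v, rfl⟩, hTp⟩

theorem exists_linearMap_comp_add_comp_eq {V M₁ M₂ : Type*} [AddCommGroup V] [Module ℝ V]
    [AddCommGroup M₁] [Module ℝ M₁] [AddCommGroup M₂] [Module ℝ M₂] (A : V →ₗ[ℝ] M₁)
    (B : V →ₗ[ℝ] M₂) (L : V →ₗ[ℝ] ℝ) (p : M₁ → ℝ) (q : M₂ → ℝ)
    (hp_smul : ∀ c : ℝ, 0 < c → ∀ z, p (c • z) = c * p z) (hp_add : ∀ z w, p (z + w) ≤ p z + p w)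
    (hq_smul : ∀ c : ℝ, 0 < c → ∀ z, q (c • z) = c * q z) (hq_add : ∀ z w, q (z + w) ≤ q z + q w)
    (hL : ∀ v, L v ≤ p (A v) + q (B v)) :
    ∃ (T : M₁ →ₗ[ℝ] ℝ) (S : M₂ →ₗ[ℝ] ℝ), T ∘ₗ A + S ∘ₗ B = L ∧ (∀ z, T z ≤ p z) ∧
      ∀ z, S z ≤ q z := by
  have hp0 : p 0 = 0 := by linarith [smul_zero (A := M₁) (2 : ℝ) ▸ hp_smul 2 two_pos 0]
  have hq0 : q 0 = 0 := by linarith [smul_zero (A := M₂) (2 : ℝ) ▸ hq_smul 2 two_pos 0]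
  obtain ⟨T, hTL, hTp⟩ := exists_linearMap_comp_eq_of_le_sublinear (A.prod B) L
    (fun z => p z.1 + q z.2)
    (fun c hc z => by rw [Prod.smul_fst, Prod.smul_snd, hp_smul c hc, hq_smul c hc, mul_add])
    (fun z w => (add_le_add (hp_add z.1 w.1) (hq_add z.2 w.2)).trans_eq (by ring)) hL
  refine ⟨T ∘ₗ LinearMap.inl ℝ M₁ M₂, T ∘ₗ LinearMap.inr ℝ M₁ M₂, ?_, fun z => ?_, fun z => ?_⟩
  · rw [← hTL]
    ext v
    simp [← map_add]
  · simpa [hq0] using hTp (z, 0)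
  · simpa [hp0] using hTp (0, z)

section Riesz

open scoped CompactlySupported

instance {X : Type*} [TopologicalSpace X] : PosSMulMono ℝ (X →ᵇ ℝ) :=
  ⟨fun _ hc _ _ hfg x => mul_le_mul_of_nonneg_left (hfg x) hc⟩

variable {X : Type*} [TopologicalSpace X] [LocallyCompactSpace X] [T2Space X] [MeasurableSpace X]
  [BorelSpace X]

theorem rieszMeasure_univ_le {P : C_c(X, ℝ) →ₚ[ℝ] ℝ} {D : ℝ}
    (hP : ∀ f : C_c(X, ℝ), (∀ x, f x ≤ 1) → P f ≤ D) :
    RealRMK.rieszMeasure P Set.univ ≤ ENNReal.ofReal D := by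
  rw [isOpen_univ.measure_eq_iSup_isCompact]
  refine iSup₂_le fun K _ => iSup_le fun hK => ?_
  obtain ⟨f, hf1, -, hfc, hf01⟩ :=
    exists_continuous_one_zero_of_isCompact hK isClosed_empty (Set.disjoint_empty K)
  let g : C_c(X, ℝ) := ⟨f, hfc⟩
  calc RealRMK.rieszMeasure P K ≤ ENNReal.ofReal (P g) :=
        RealRMK.rieszMeasure_le_of_eq_one P (f := g) (fun x => (hf01 x).1) hK hf1
    _ ≤ ENNReal.ofReal D := ENNReal.ofReal_le_ofReal (hP g fun x => (hf01 x).2)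

theorem exists_measure_of_le_norm_posPart (T : (X →ᵇ ℝ) →ₗ[ℝ] ℝ) {D : ℝ} (hD : 0 ≤ D)
    (hT : ∀ h, T h ≤ D * ‖h⁺‖) :
    ∃ μ : Measure X, μ Set.univ ≤ ENNReal.ofReal D ∧
      ∀ h : X →ᵇ ℝ, HasCompactSupport h → T h = ∫ x, h x ∂μ := by
  have hpos : ∀ h : X →ᵇ ℝ, 0 ≤ h → 0 ≤ T h := fun h hh => by
    have := hT (-h)
    rw [posPart_eq_zero.2 (neg_nonpos.2 hh), norm_zero, mul_zero, map_neg] at this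
    linarith
  let P : C_c(X, ℝ) →ₚ[ℝ] ℝ := PositiveLinearMap.mk₀
    { toFun := fun f => T f.toBoundedContinuousFunction
      map_add' := fun f g => T.map_add f.toBoundedContinuousFunction g.toBoundedContinuousFunction
      map_smul' := fun c f => T.map_smul c f.toBoundedContinuousFunction } fun f hf => hpos _ hf
  refine ⟨RealRMK.rieszMeasure P, rieszMeasure_univ_le fun f hf => ?_, fun h hh =>
    (RealRMK.integral_rieszMeasure P ⟨h.toContinuousMap, hh⟩).symm⟩
  refine (hT f.toBoundedContinuousFunction).trans (mul_le_of_le_one_right hD ?_)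
  refine (BoundedContinuousFunction.norm_le zero_le_one).2 fun x => ?_
  exact (Real.norm_of_nonneg (posPart_nonneg f.toBoundedContinuousFunction x)).trans_le
    (max_le (hf x) zero_le_one)

theorem exists_measures_of_le_norm_posPart {V Y : Type*} [AddCommGroup V] [Module ℝ V]
    [TopologicalSpace Y] [LocallyCompactSpace Y] [T2Space Y] [MeasurableSpace Y] [BorelSpace Y]
    (A : V →ₗ[ℝ] X →ᵇ ℝ) (B : V →ₗ[ℝ] Y →ᵇ ℝ) (hA : ∀ v, HasCompactSupport (A v))
    (hB : ∀ v, HasCompactSupport (B v)) (L : V →ₗ[ℝ] ℝ) {D E : ℝ} (hD : 0 ≤ D) (hE : 0 ≤ E)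
    (hL : ∀ v, L v ≤ D * ‖(A v)⁺‖ + E * ‖(B v)⁺‖) :
    ∃ (μ : Measure X) (ν : Measure Y), μ Set.univ ≤ ENNReal.ofReal D ∧
      ν Set.univ ≤ ENNReal.ofReal E ∧ ∀ v, L v = ∫ x, A v x ∂μ + ∫ y, B v y ∂ν := by
  obtain ⟨T, S, hTS, hT, hS⟩ := exists_linearMap_comp_add_comp_eq A B L
    (fun h => D * ‖h⁺‖) (fun h => E * ‖h⁺‖)
    (fun c hc h => by rw [norm_posPart_smul_of_pos hc]; ring)
    (fun h k => (mul_le_mul_of_nonneg_left (norm_posPart_add_le h k) hD).trans_eq (mul_add ..))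
    (fun c hc h => by rw [norm_posPart_smul_of_pos hc]; ring)
    (fun h k => (mul_le_mul_of_nonneg_left (norm_posPart_add_le h k) hE).trans_eq (mul_add ..)) hL
  obtain ⟨μ, hμD, hμ⟩ := exists_measure_of_le_norm_posPart T hD hT
  obtain ⟨ν, hνE, hν⟩ := exists_measure_of_le_norm_posPart S hE hS
  refine ⟨μ, ν, hμD, hνE, fun v => ?_⟩
  rw [← hμ _ (hA v), ← hν _ (hB v), ← hTS]
  rfl

end Riesz

section PushforwardOfDensity

variable {X Y E F G : Type*} [MeasurableSpace X] [MeasurableSpace Y] [NormedAddCommGroup E]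
  [NormedSpace ℝ E] [NormedAddCommGroup F] [NormedSpace ℝ F] [CompleteSpace F]
  [NormedAddCommGroup G] [NormedSpace ℝ G] [CompleteSpace G] {μ : Measure X} {s : X → F}
  {π : X → Y}

theorem variation_map_withDensityᵥ_le (hs : Integrable s μ) (hs1 : ∀ x, ‖s x‖ ≤ 1)
    (hπ : Measurable π) : ((μ.withDensityᵥ s).map π).variation ≤ μ.map π := by
  refine VectorMeasure.variation_map_le.trans (Measure.map_mono ?_ hπ)
  rw [Measure.variation_withDensityᵥ hs]
  calc μ.withDensity (fun x => ‖s x‖ₑ) ≤ μ.withDensity 1 :=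
        withDensity_mono (ae_of_all _ fun x => by
          simpa [enorm_eq_nnnorm, ← NNReal.coe_le_coe] using hs1 x)
    _ = μ := withDensity_one

variable [IsFiniteMeasure μ]

theorem isFiniteMeasure_variation_map_withDensityᵥ (hs : Integrable s μ) (hs1 : ∀ x, ‖s x‖ ≤ 1)
    (hπ : Measurable π) : IsFiniteMeasure ((μ.withDensityᵥ s).map π).variation :=
  isFiniteMeasure_of_le _ (variation_map_withDensityᵥ_le hs hs1 hπ)

theorem integral_map_withDensityᵥ_simpleFunc (hs : Integrable s μ) (hs1 : ∀ x, ‖s x‖ ≤ 1)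
    (hπ : Measurable π) (B : E →L[ℝ] F →L[ℝ] G) (f : SimpleFunc Y E) :
    Integrable (fun x => B (f (π x)) (s x)) μ ∧
      ∫ᵛ y, f y ∂[B; (μ.withDensityᵥ s).map π] = ∫ x, B (f (π x)) (s x) ∂μ := by
  have := isFiniteMeasure_variation_map_withDensityᵥ hs hs1 hπ
  induction f using SimpleFunc.induction with
  | const c hA =>
    rename_i A
    have hpull : (fun x => B (A.indicator (Function.const Y c) (π x)) (s x)) =
        (π ⁻¹' A).indicator fun x => B c (s x) := by
      ext x
      by_cases hx : π x ∈ A <;> simp [hx]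
    have hBs : Integrable (fun x => B c (s x)) μ := (B c).integrable_comp hs
    simp only [SimpleFunc.coe_piecewise, SimpleFunc.coe_const, Function.const_zero,
      Set.piecewise_eq_indicator, hpull]
    refine ⟨hBs.indicator (hπ hA), ?_⟩
    rw [integral_indicator (hπ hA), (B c).integral_comp_comm hs.integrableOn,
      ← withDensityᵥ_apply hs (hπ hA), ← VectorMeasure.map_apply _ hπ hA]
    exact setToFun_indicator_const _ hA (measure_ne_top _ A) c
  | add _ hf hg =>
    simp only [SimpleFunc.coe_add, Pi.add_apply, map_add, add_apply]
    refine ⟨hf.1.add hg.1, ?_⟩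
    rw [VectorMeasure.integral_fun_add (SimpleFunc.integrable_of_isFiniteMeasure _)
      (SimpleFunc.integrable_of_isFiniteMeasure _), integral_add hf.1 hg.1, hf.2, hg.2]

theorem integral_map_withDensityᵥ (hs : Integrable s μ) (hs1 : ∀ x, ‖s x‖ ≤ 1)
    (hπ : Measurable π) (B : E →L[ℝ] F →L[ℝ] G) {f : Y → E} (hf : StronglyMeasurable f) {C : ℝ}
    (hC0 : 0 ≤ C) (hC : ∀ y, ‖f y‖ ≤ C) :
    ∫ᵛ y, f y ∂[B; (μ.withDensityᵥ s).map π] = ∫ x, B (f (π x)) (s x) ∂μ := by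
  have := isFiniteMeasure_variation_map_withDensityᵥ hs hs1 hπ
  have happrox : ∀ y, Tendsto (fun n => hf.approxBounded C n y) atTop (𝓝 (f y)) := fun y =>
    hf.tendsto_approxBounded_of_norm_le (hC y)
  have hleft := tendsto_setToFun_of_dominated_convergence
    (dominatedFinMeasAdditive_cbmApplyMeasure ((μ.withDensityᵥ s).map π) B) (fun _ => C)
    (fun n => (hf.approxBounded C n).aestronglyMeasurable) (integrable_const C)
    (fun n => ae_of_all _ (hf.norm_approxBounded_le hC0 n)) (ae_of_all _ happrox)
  refine tendsto_nhds_unique hleft (Tendsto.congr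
    (fun n => ((integral_map_withDensityᵥ_simpleFunc hs hs1 hπ B _).2).symm) ?_)
  refine tendsto_integral_of_dominated_convergence (fun _ => ‖B‖ * C)
    (fun n => (integral_map_withDensityᵥ_simpleFunc hs hs1 hπ B _).1.aestronglyMeasurable)
    (integrable_const _) (fun n => ae_of_all _ fun x => ?_) (ae_of_all _ fun x =>
      ((B.flip (s x)).continuous.tendsto _).comp (happrox (π x)))
  calc ‖B (hf.approxBounded C n (π x)) (s x)‖
      ≤ ‖B‖ * ‖hf.approxBounded C n (π x)‖ * ‖s x‖ := B.le_opNorm₂ _ _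
    _ ≤ ‖B‖ * C * 1 := by
        gcongr
        exacts [hf.norm_approxBounded_le hC0 n _, hs1 x]
    _ = ‖B‖ * C := mul_one _

end PushforwardOfDensity

section Representation

section NormedSpace

variable {E : Type*} [NormedAddCommGroup E] [NormedSpace ℝ E] {K : Set E}

/-- The restriction of test functions to a closed set. -/
noncomputable def restrictToClosed (hK : IsClosed K) : 𝓓((⊤ : Opens E), ℝ) →ₗ[ℝ] K →ᵇ ℝ where
  toFun φ := CompactlySupportedContinuousMap.toBoundedContinuousFunction
    ⟨⟨fun p => φ (p : E), φ.continuous.comp continuous_subtype_val⟩,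
      φ.hasCompactSupport.comp_isClosedEmbedding hK.isClosedEmbedding_subtypeVal⟩
  map_add' φ ψ := by
    ext
    simp
  map_smul' c φ := by
    ext
    simp

theorem le_norm_posPart_restrictToClosed (hK : IsClosed K) (φ : 𝓓((⊤ : Opens E), ℝ)) {x : E}
    (hx : x ∈ K) : φ x ≤ ‖(restrictToClosed hK φ)⁺‖ :=
  (le_posPart (restrictToClosed hK φ) ⟨x, hx⟩).trans
    ((le_abs_self _).trans ((restrictToClosed hK φ)⁺.norm_coe_le_norm _))

variable [FiniteDimensional ℝ E]

theorem hasCompactSupport_fderiv_apply_unitBall (hK : IsClosed K) {φ : E → ℝ}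
    (hφ : HasCompactSupport φ) :
    HasCompactSupport fun p : K × Metric.closedBall (0 : E) 1 => fderiv ℝ φ p.1 p.2 := by
  have := FiniteDimensional.proper_real E
  have hcompact : IsCompact ((tsupport φ) ×ˢ Metric.closedBall (0 : E) 1) :=
    hφ.isCompact.prod (isCompact_closedBall _ _)
  refine HasCompactSupport.intro ((hK.isClosedEmbedding_subtypeVal.prodMap
    Metric.isClosed_closedBall.isClosedEmbedding_subtypeVal).isCompact_preimage hcompact)
    fun p hp => ?_
  have hp1 : (p.1 : E) ∉ tsupport φ := fun h => hp ⟨h, p.2.2⟩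
  rw [Function.notMem_support.1 fun h => hp1 (support_fderiv_subset ℝ h), zero_apply]

/-- The directional derivatives of test functions at the points of `K` in the directions of the
unit ball. The supremum of their positive part is the supremum on `K` of the norm of the
derivative. -/
noncomputable def directionalDeriv (hK : IsClosed K) :
    𝓓((⊤ : Opens E), ℝ) →ₗ[ℝ] (K × Metric.closedBall (0 : E) 1) →ᵇ ℝ where
  toFun φ := CompactlySupportedContinuousMap.toBoundedContinuousFunction
    ⟨⟨fun p => fderiv ℝ φ (p.1 : E) (p.2 : E), by
        have := φ.contDiff.continuous_fderiv (by simp)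
        fun_prop⟩, hasCompactSupport_fderiv_apply_unitBall hK φ.hasCompactSupport⟩
  map_add' φ ψ := by
    ext p
    simp [fderiv_add (φ.contDiff.differentiable (by simp) (p.1 : E))
      (ψ.contDiff.differentiable (by simp) (p.1 : E))]
  map_smul' c φ := by
    ext p
    simp [fderiv_const_smul (φ.contDiff.differentiable (by simp) (p.1 : E))]

theorem norm_fderiv_le_norm_posPart_directionalDeriv (hK : IsClosed K) (φ : 𝓓((⊤ : Opens E), ℝ))
    {x : E} (hx : x ∈ K) : ‖fderiv ℝ φ x‖ ≤ ‖(directionalDeriv hK φ)⁺‖ := by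
  have hle : ∀ v : E, ‖v‖ = 1 → fderiv ℝ φ x v ≤ ‖(directionalDeriv hK φ)⁺‖ := fun v hv =>
    (le_posPart (directionalDeriv hK φ) (⟨x, hx⟩, ⟨v, mem_closedBall_zero_iff.2 hv.le⟩)).trans
      ((le_abs_self _).trans ((directionalDeriv hK φ)⁺.norm_coe_le_norm _))
  refine ContinuousLinearMap.opNorm_le_of_unit_norm (norm_nonneg _) fun v hv =>
    abs_le'.2 ⟨hle v hv, ?_⟩
  rw [← map_neg]
  exact hle (-v) (by rwa [norm_neg])

end NormedSpace

variable {N : ℕ}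

theorem inner_gradient_eq_fderiv (φ : RN N → ℝ) (x v : RN N) : ⟪∇ φ x, v⟫ = fderiv ℝ φ x v := by
  simp [gradient]

theorem norm_gradient_eq_norm_fderiv (φ : RN N → ℝ) (x : RN N) : ‖∇ φ x‖ = ‖fderiv ℝ φ x‖ := by
  simp [gradient]

theorem continuous_gradient_testFunction {Ω : Opens (RN N)} (φ : 𝓓(Ω, ℝ)) :
    Continuous (∇ (φ : RN N → ℝ)) :=
  (InnerProductSpace.toDual ℝ (RN N)).symm.continuous.comp (φ.contDiff.continuous_fderiv (by simp))

theorem exists_norm_gradient_testFunction_le {Ω : Opens (RN N)} (φ : 𝓓(Ω, ℝ)) :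
    ∃ C, 0 ≤ C ∧ ∀ x, ‖∇ (φ : RN N → ℝ) x‖ ≤ C := by
  obtain ⟨C, hC⟩ := (φ.hasCompactSupport.fderiv (𝕜 := ℝ)).exists_bound_of_continuous
    (φ.contDiff.continuous_fderiv (by simp))
  exact ⟨C, (norm_nonneg _).trans (hC 0),
    fun x => (norm_gradient_eq_norm_fderiv φ x).trans_le (hC x)⟩

theorem abs_gradPairing_le {σ : VectorMeasure (RN N) (RN N)} (hσ : IsBoundedVectorMeasure σ)
    {φ : RN N → ℝ} {C : ℝ} (hφ : ∀ x, ‖∇ φ x‖ ≤ C) :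
    |gradPairing σ φ| ≤ C * σ.variation.real Set.univ := by
  have : IsFiniteMeasure σ.variation := hσ
  have hC : 0 ≤ C := (norm_nonneg _).trans (hφ 0)
  calc |gradPairing σ φ| ≤ C * ‖euclideanPairing N‖ * σ.variation.real Set.univ :=
        VectorMeasure.norm_integral_le_of_norm_le_const (μ := σ) (B := euclideanPairing N)
          (ae_of_all _ hφ)
    _ ≤ C * 1 * σ.variation.real Set.univ := by gcongr; exact norm_innerSL_le ℝ
    _ = C * σ.variation.real Set.univ := by rw [mul_one]

theorem exists_gradPairing_eq_integral_directionalDeriv {K : Set (RN N)} (hK : IsClosed K)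
    (μ : Measure (K × Metric.closedBall (0 : RN N) 1)) [IsFiniteMeasure μ] :
    ∃ σ : VectorMeasure (RN N) (RN N), IsBoundedVectorMeasure σ ∧
      σ.variation Set.univ ≤ μ Set.univ ∧ σ.variation Kᶜ = 0 ∧
      ∀ φ : 𝓓((⊤ : Opens (RN N)), ℝ), gradPairing σ φ = ∫ p, directionalDeriv hK φ p ∂μ := by
  let s : K × Metric.closedBall (0 : RN N) 1 → RN N := fun p => p.2
  let π : K × Metric.closedBall (0 : RN N) 1 → RN N := fun p => p.1
  have hπ : Measurable π := by fun_prop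
  have hs1 : ∀ p, ‖s p‖ ≤ 1 := fun p => mem_closedBall_zero_iff.1 p.2.2
  have hs : Integrable s μ := Integrable.of_bound (by fun_prop) 1 (ae_of_all _ hs1)
  have hvar := variation_map_withDensityᵥ_le hs hs1 hπ
  refine ⟨(μ.withDensityᵥ s).map π, isFiniteMeasure_variation_map_withDensityᵥ hs hs1 hπ,
    (hvar _).trans_eq ?_, nonpos_iff_eq_zero.1 ((hvar _).trans_eq ?_), fun φ => ?_⟩
  · rw [Measure.map_apply hπ MeasurableSet.univ, Set.preimage_univ]
  · rw [Measure.map_apply hπ hK.measurableSet.compl,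
      Set.preimage_eq_empty (Set.disjoint_left.2 (by rintro _ hx ⟨p, rfl⟩; exact hx p.1.2)),
      measure_empty]
  · obtain ⟨C, hC0, hC⟩ := exists_norm_gradient_testFunction_le φ
    rw [gradPairing, integral_map_withDensityᵥ hs hs1 hπ (euclideanPairing N)
      (continuous_gradient_testFunction φ).stronglyMeasurable hC0 hC]
    exact integral_congr_ae (ae_of_all _ fun p => inner_gradient_eq_fderiv _ _ _)

theorem exists_gradPairing_add_integral_eq {K S : Set (RN N)} (hK : IsClosed K) (hS : IsClosed S)
    (L : 𝓓((⊤ : Opens (RN N)), ℝ) →ₗ[ℝ] ℝ) {D E : ℝ} (hD : 0 ≤ D) (hE : 0 ≤ E)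
    (hL : ∀ (φ : 𝓓((⊤ : Opens (RN N)), ℝ)) (a b : ℝ), 0 ≤ a → 0 ≤ b →
      (∀ x ∈ K, ‖fderiv ℝ φ x‖ ≤ a) → (∀ x ∈ S, φ x ≤ b) → L φ ≤ D * a + E * b) :
    ∃ (σ : VectorMeasure (RN N) (RN N)) (ν : Measure (RN N)), IsBoundedVectorMeasure σ ∧
      σ.variation.real Set.univ ≤ D ∧ σ.variation Kᶜ = 0 ∧
      IsFiniteMeasure ν ∧ ν.real Set.univ ≤ E ∧ ν Sᶜ = 0 ∧
      ∀ φ : 𝓓((⊤ : Opens (RN N)), ℝ), L φ = gradPairing σ φ + ∫ x, φ x ∂ν := by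
  have := hK.isClosedEmbedding_subtypeVal.locallyCompactSpace
  have := hS.isClosedEmbedding_subtypeVal.locallyCompactSpace
  have := (Metric.isClosed_closedBall (x := (0 : RN N)) (ε := 1)).isClosedEmbedding_subtypeVal
    |>.locallyCompactSpace
  obtain ⟨μ, ν, hμD, hνE, hμν⟩ := exists_measures_of_le_norm_posPart (directionalDeriv hK)
    (restrictToClosed hS)
    (fun φ => hasCompactSupport_fderiv_apply_unitBall hK φ.hasCompactSupport)
    (fun φ => φ.hasCompactSupport.comp_isClosedEmbedding hS.isClosedEmbedding_subtypeVal) L hD hE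
    (fun φ => hL φ _ _ (norm_nonneg _) (norm_nonneg _)
      (fun _ => norm_fderiv_le_norm_posPart_directionalDeriv hK φ)
      (fun _ => le_norm_posPart_restrictToClosed hS φ))
  have : IsFiniteMeasure μ := ⟨hμD.trans_lt ENNReal.ofReal_lt_top⟩
  have : IsFiniteMeasure ν := ⟨hνE.trans_lt ENNReal.ofReal_lt_top⟩
  obtain ⟨σ, hσ, hσμ, hσK, hσφ⟩ := exists_gradPairing_eq_integral_directionalDeriv hK μ
  refine ⟨σ, ν.map (↑), hσ, ENNReal.toReal_le_of_le_ofReal hD (hσμ.trans hμD), hσK,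
    Measure.isFiniteMeasure_map ν _, ?_, ?_, fun φ => ?_⟩
  · rw [measureReal_def, Measure.map_apply measurable_subtype_coe MeasurableSet.univ]
    exact ENNReal.toReal_le_of_le_ofReal hE hνE
  · rw [Measure.map_apply measurable_subtype_coe hS.measurableSet.compl]
    simp
  · rw [hμν, hσφ, integral_map measurable_subtype_coe.aemeasurable
      φ.continuous.aestronglyMeasurable]
    rfl

end Representation

section LeastMass

theorem abs_integral_sub_le_of_lipschitzWith {X : Type*} [PseudoMetricSpace X] [MeasurableSpace X]
    {μ : Measure X} [IsProbabilityMeasure μ] {C : NNReal} {g : X → ℝ} (hg : LipschitzWith C g)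
    (hgi : Integrable g μ) {x₀ : X} {R : ℝ} (hR : ∀ᵐ x ∂μ, dist x x₀ ≤ R) :
    |∫ x, g x ∂μ - g x₀| ≤ C * R := by
  have hbound : ∀ᵐ x ∂μ, ‖g x - g x₀‖ ≤ C * R := by
    filter_upwards [hR] with x hx
    exact (hg.dist_le_mul x x₀).trans (by gcongr)
  simpa [integral_sub hgi (integrable_const _)] using norm_integral_le_of_norm_le_const hbound

variable {N : ℕ}

theorem integrable_testFunction {Ω : Opens (RN N)} (φ : 𝓓(Ω, ℝ)) (μ : Measure (RN N))
    [IsFiniteMeasureOnCompacts μ] : Integrable φ μ :=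
  φ.continuous.integrable_of_hasCompactSupport φ.hasCompactSupport

/-- A measure, as a linear form on test functions. -/
noncomputable def integralLinearForm (μ : Measure (RN N)) [IsFiniteMeasureOnCompacts μ] :
    𝓓((⊤ : Opens (RN N)), ℝ) →ₗ[ℝ] ℝ where
  toFun φ := ∫ x, φ x ∂μ
  map_add' φ ψ := integral_add (integrable_testFunction φ μ) (integrable_testFunction ψ μ)
  map_smul' c _ := integral_const_mul c _

theorem integralLinearForm_apply (μ : Measure (RN N)) [IsFiniteMeasureOnCompacts μ]
    (φ : 𝓓((⊤ : Opens (RN N)), ℝ)) : integralLinearForm μ φ = ∫ x, φ x ∂μ :=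
  rfl

/-- The values of a linear form on the `1`-Lipschitz test functions. Their supremum is the dual
norm of the form for the norm `sup ‖∇φ‖`. -/
def lipschitzValues (L : 𝓓((⊤ : Opens (RN N)), ℝ) →ₗ[ℝ] ℝ) : Set ℝ :=
  {r | ∃ φ : 𝓓((⊤ : Opens (RN N)), ℝ), (∀ x, ‖fderiv ℝ φ x‖ ≤ 1) ∧ L φ = r}

theorem zero_mem_lipschitzValues (L : 𝓓((⊤ : Opens (RN N)), ℝ) →ₗ[ℝ] ℝ) :
    0 ∈ lipschitzValues L := by
  refine ⟨0, fun x => ?_, map_zero L⟩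
  change ‖fderiv ℝ (fun _ : RN N => (0 : ℝ)) x‖ ≤ 1
  simp

theorem le_sSup_lipschitzValues_mul {L : 𝓓((⊤ : Opens (RN N)), ℝ) →ₗ[ℝ] ℝ}
    (hL : BddAbove (lipschitzValues L)) {φ : 𝓓((⊤ : Opens (RN N)), ℝ)} {a : ℝ} (ha : 0 ≤ a)
    (hφ : ∀ x, ‖fderiv ℝ φ x‖ ≤ a) : L φ ≤ sSup (lipschitzValues L) * a := by
  have hscale : ∀ b > a, L φ ≤ sSup (lipschitzValues L) * b := fun b hb => by
    have hb0 : 0 < b := ha.trans_lt hb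
    have hle : L (b⁻¹ • φ) ≤ sSup (lipschitzValues L) := le_csSup hL ⟨b⁻¹ • φ, fun x => by
      have hsmul : fderiv ℝ (b⁻¹ • φ : 𝓓((⊤ : Opens (RN N)), ℝ)) x = b⁻¹ • fderiv ℝ φ x :=
        fderiv_const_smul (φ.contDiff.differentiable (by simp) x) b⁻¹
      rw [hsmul, norm_smul, norm_inv, Real.norm_of_nonneg hb0.le, inv_mul_le_one₀ hb0]
      exact (hφ x).trans hb.le, rfl⟩
    rwa [map_smul, smul_eq_mul, inv_mul_le_iff₀ hb0, mul_comm] at hle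
  have hlim : Tendsto (fun b => sSup (lipschitzValues L) * b) (𝓝[>] a)
      (𝓝 (sSup (lipschitzValues L) * a)) :=
    (continuous_const_mul _).continuousWithinAt
  exact ge_of_tendsto hlim (by filter_upwards [self_mem_nhdsWithin] using hscale)

theorem sSup_lipschitzValues_le_variation {L : 𝓓((⊤ : Opens (RN N)), ℝ) →ₗ[ℝ] ℝ}
    {σ : VectorMeasure (RN N) (RN N)} (hσ : IsBoundedVectorMeasure σ)
    (hσL : ∀ φ : 𝓓((⊤ : Opens (RN N)), ℝ), gradPairing σ φ = L φ) :
    sSup (lipschitzValues L) ≤ σ.variation.real Set.univ := by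
  refine csSup_le ⟨0, zero_mem_lipschitzValues L⟩ ?_
  rintro _ ⟨φ, hφ, rfl⟩
  rw [← hσL, ← one_mul (σ.variation.real Set.univ)]
  exact (le_abs_self _).trans
    (abs_gradPairing_le hσ fun x => (norm_gradient_eq_norm_fderiv φ x).trans_le (hφ x))

theorem exists_gradPairing_eq_variation_eq_sSup {L : 𝓓((⊤ : Opens (RN N)), ℝ) →ₗ[ℝ] ℝ}
    (hL : BddAbove (lipschitzValues L)) :
    ∃ σ : VectorMeasure (RN N) (RN N), IsBoundedVectorMeasure σ ∧
      (∀ φ : 𝓓((⊤ : Opens (RN N)), ℝ), gradPairing σ φ = L φ) ∧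
      σ.variation.real Set.univ = sSup (lipschitzValues L) := by
  obtain ⟨σ, ν, hσ, hσle, -, -, -, hν, hLσ⟩ := exists_gradPairing_add_integral_eq isClosed_univ
    isClosed_empty L (le_csSup hL (zero_mem_lipschitzValues L)) le_rfl
    fun φ a b ha _ hφ _ => by
      rw [zero_mul, add_zero]
      exact le_sSup_lipschitzValues_mul hL ha fun x => hφ x (Set.mem_univ x)
  rw [Set.compl_empty, Measure.measure_univ_eq_zero] at hν
  have hσL : ∀ φ : 𝓓((⊤ : Opens (RN N)), ℝ), gradPairing σ φ = L φ := fun φ => by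
    rw [hLσ, hν, integral_zero_measure, add_zero]
  exact ⟨σ, hσ, hσL, hσle.antisymm (sSup_lipschitzValues_le_variation hσ hσL)⟩

theorem bddAbove_lipschitzValues_sub {f ν : Measure (RN N)} [IsProbabilityMeasure f]
    [IsProbabilityMeasure ν] {K : Set (RN N)} (hK : Bornology.IsBounded K) (hf : f Kᶜ = 0)
    (hν : ν Kᶜ = 0) :
    BddAbove (lipschitzValues (integralLinearForm f - integralLinearForm ν)) := by
  obtain ⟨R, hR⟩ := hK.subset_closedBall (0 : RN N)
  have hbound : ∀ (μ : Measure (RN N)) [IsProbabilityMeasure μ], μ Kᶜ = 0 →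
      ∀ φ : 𝓓((⊤ : Opens (RN N)), ℝ), (∀ x, ‖fderiv ℝ φ x‖ ≤ 1) →
      |∫ x, φ x ∂μ - φ 0| ≤ R := fun μ _ hμ φ hφ => by
    have hlip : LipschitzWith 1 φ :=
      lipschitzWith_of_nnnorm_fderiv_le (𝕜 := ℝ) (φ.contDiff.differentiable (by simp)) hφ
    simpa using abs_integral_sub_le_of_lipschitzWith hlip (integrable_testFunction φ μ)
      (measure_mono_null (Set.compl_subset_compl.2 hR) hμ)
  refine ⟨2 * R, ?_⟩
  rintro _ ⟨φ, hφ, rfl⟩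
  have hle_f := (abs_le.1 (hbound f hf φ hφ)).2
  have hle_ν := (abs_le.1 (hbound ν hν φ hφ)).1
  rw [LinearMap.sub_apply, integralLinearForm_apply, integralLinearForm_apply]
  linarith

theorem exists_isLeast_dualValues {f ν : Measure (RN N)} [IsProbabilityMeasure f]
    [IsProbabilityMeasure ν] {K : Set (RN N)} (hK : Bornology.IsBounded K) (hf : f Kᶜ = 0)
    (hν : ν Kᶜ = 0) {Λ : ℝ} (hΛ : 0 ≤ Λ) : ∃ m, IsLeast (dualValues f Λ ν) m := by
  obtain ⟨σ, hσ, hdiv, hσW⟩ :=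
    exists_gradPairing_eq_variation_eq_sSup (bddAbove_lipschitzValues_sub hK hf hν)
  refine ⟨_, ⟨σ, hσ, hdiv, rfl⟩, ?_⟩
  rintro _ ⟨σ', hσ', hdiv', rfl⟩
  rw [hσW]
  exact mul_le_mul_of_nonneg_left (sSup_lipschitzValues_le_variation hσ' hdiv') hΛ

end LeastMass

section LipschitzOfAEGradient

variable {E : Type*} [NormedAddCommGroup E] [NormedSpace ℝ E]

theorem ae_ae_add_smul_of_ae [SecondCountableTopology E] [MeasurableSpace E] [BorelSpace E]
    {μ : Measure E} [SFinite μ] [μ.IsAddRightInvariant] {p : E → Prop} (hp : ∀ᵐ x ∂μ, p x) (v : E) :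
    ∀ᵐ x ∂μ, ∀ᵐ t : ℝ, p (x + t • v) := by
  obtain ⟨T, hpT, hT, hT0⟩ := exists_measurable_superset_of_null (ae_iff.1 hp)
  have htranslate : ∀ t : ℝ, ∀ᵐ x ∂μ, x + t • v ∉ T := fun t =>
    (measurePreserving_add_right μ (t • v)).quasiMeasurePreserving.ae (compl_mem_ae_iff.2 hT0)
  have hline : ∀ᵐ x ∂μ, ∀ᵐ t : ℝ, x + t • v ∉ T := by
    rw [Measure.ae_ae_comm]
    · exact ae_of_all _ htranslate
    · exact hT.compl.preimage (by fun_prop : Measurable fun q : E × ℝ => q.1 + q.2 • v)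
  filter_upwards [hline] with x hx
  filter_upwards [hx] with t ht
  exact by_contra fun h => ht (hpT h)

theorem abs_sub_le_of_ae_norm_fderiv_le_on_segment {C : NNReal} {g : E → ℝ} {s : Set E}
    (hg : LipschitzOnWith C g s) {Λ : ℝ} {x v : E} (hs : ∀ t ∈ Set.Icc (0 : ℝ) 1, x + t • v ∈ s)
    (hΛ : ∀ᵐ t : ℝ, x + t • v ∈ s →
      DifferentiableAt ℝ g (x + t • v) ∧ ‖fderiv ℝ g (x + t • v)‖ ≤ Λ) :
    |g (x + v) - g x| ≤ Λ * ‖v‖ := by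
  have hline : LipschitzWith ‖v‖₊ fun t : ℝ => x + t • v :=
    LipschitzWith.of_dist_le_mul fun t t' => by
      rw [dist_add_left, dist_eq_norm, ← sub_smul, norm_smul, dist_eq_norm, coe_nnnorm, mul_comm]
  have hlip : LipschitzOnWith (C * ‖v‖₊) (fun t : ℝ => g (x + t • v)) (Set.uIcc 0 1) :=
    hg.comp hline.lipschitzOnWith fun t ht => hs t (by rwa [Set.uIcc_of_le zero_le_one] at ht)
  have hderiv : ∀ᵐ t : ℝ, t ∈ Set.uIoc (0 : ℝ) 1 →
      ‖deriv (fun t : ℝ => g (x + t • v)) t‖ ≤ Λ * ‖v‖ := by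
    filter_upwards [hΛ] with t ht htI
    rw [Set.uIoc_of_le zero_le_one] at htI
    obtain ⟨hd, hle⟩ := ht (hs t ⟨htI.1.le, htI.2⟩)
    have hv : HasDerivAt (fun t : ℝ => x + t • v) v t := by
      simpa using ((hasDerivAt_id t).smul_const v).const_add x
    have hchain : HasDerivAt (fun t : ℝ => g (x + t • v)) (fderiv ℝ g (x + t • v) v) t :=
      hd.hasFDerivAt.comp_hasDerivAt t hv
    rw [hchain.deriv]
    exact (fderiv ℝ g _).le_of_opNorm_le hle v
  have hftc := intervalIntegral.norm_integral_le_of_norm_le_const_ae hderiv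
  rw [hlip.absolutelyContinuousOnInterval.integral_deriv_eq_sub] at hftc
  simpa using hftc

theorem abs_sub_le_of_ae_norm_fderiv_le [FiniteDimensional ℝ E] [MeasurableSpace E] [BorelSpace E]
    {μ : Measure E} [μ.IsAddHaarMeasure] {C : NNReal} {g : E → ℝ} {s : Set E} (hso : IsOpen s)
    (hsc : Convex ℝ s) (hg : LipschitzOnWith C g s) {Λ : ℝ}
    (hΛ : ∀ᵐ x ∂μ, x ∈ s → DifferentiableAt ℝ g x ∧ ‖fderiv ℝ g x‖ ≤ Λ) {x y : E}
    (hx : x ∈ s) (hy : y ∈ s) : |g y - g x| ≤ Λ * ‖y - x‖ := by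
  have hae : ∀ᵐ z ∂μ, z ∈ s → z + (y - x) ∈ s → |g (z + (y - x)) - g z| ≤ Λ * ‖y - x‖ := by
    filter_upwards [ae_ae_add_smul_of_ae hΛ (y - x)] with z hz hz0 hz1
    exact abs_sub_le_of_ae_norm_fderiv_le_on_segment hg
      (fun t ht => hsc.add_smul_mem hz0 hz1 ht) hz
  have hyx : x + (y - x) = y := add_sub_cancel x y
  have hshift : Tendsto (fun z => z + (y - x)) (𝓝 x) (𝓝 y) :=
    (continuous_add_const (y - x)).tendsto' _ _ hyx
  have hlim : Tendsto (fun z => |g (z + (y - x)) - g z|) (𝓝 x) (𝓝 |g y - g x|) :=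
    (((hg.continuousOn.continuousAt (hso.mem_nhds hy)).tendsto.comp hshift).sub
      (hg.continuousOn.continuousAt (hso.mem_nhds hx)).tendsto).abs
  have hfreq := mem_closure_iff_frequently.1 ((Measure.dense_of_ae hae).closure_eq ▸ Set.mem_univ x)
  refine le_of_tendsto_of_frequently hlim ?_
  have hmem : ∀ᶠ z in 𝓝 x, z ∈ s ∧ z + (y - x) ∈ s :=
    (hso.eventually_mem hx).and (hshift.eventually (hso.eventually_mem hy))
  exact (hfreq.and_eventually hmem).mono fun z hz => hz.1 hz.2.1 hz.2.2

end LipschitzOfAEGradient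

section DistanceToComplement

theorem exists_mem_frontier_closedBall_subset_closure {E : Type*} [NormedAddCommGroup E]
    [NormedSpace ℝ E] [FiniteDimensional ℝ E] {s : Set E} (hs : s ≠ Set.univ) {x : E}
    (hx : x ∈ closure s) :
    ∃ y ∈ frontier s, Metric.infDist x sᶜ = dist x y ∧
      Metric.closedBall x (Metric.infDist x sᶜ) ⊆ closure s := by
  by_cases hxs : x ∈ s
  · obtain ⟨y, hy, hxy⟩ := exists_mem_frontier_infDist_compl_eq_dist hxs hs
    exact ⟨y, hy, hxy, Metric.closedBall_infDist_compl_subset_closure hxs⟩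
  · have hdist : Metric.infDist x sᶜ = 0 := Metric.infDist_zero_of_mem hxs
    refine ⟨x, ⟨hx, fun h => hxs (interior_subset h)⟩, by rw [hdist, dist_self], ?_⟩
    rwa [hdist, Metric.closedBall_zero, Set.singleton_subset_iff]

theorem le_mul_infDist_compl_add {E : Type*} [NormedAddCommGroup E] [NormedSpace ℝ E]
    [FiniteDimensional ℝ E] {s : Set E} (hs : s ≠ Set.univ) {φ : E → ℝ} (hφ : Differentiable ℝ φ)
    {a b : ℝ} (ha : ∀ x ∈ closure s, ‖fderiv ℝ φ x‖ ≤ a) (hb : ∀ x ∈ frontier s, φ x ≤ b) {x : E}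
    (hx : x ∈ closure s) : φ x ≤ a * Metric.infDist x sᶜ + b := by
  obtain ⟨y, hy, hxy, hball⟩ := exists_mem_frontier_closedBall_subset_closure hs hx
  have hmv := (convex_closedBall x (Metric.infDist x sᶜ)).norm_image_sub_le_of_norm_fderiv_le
    (𝕜 := ℝ) (fun z _ => hφ z) (fun z hz => ha z (hball hz))
    (Metric.mem_closedBall.2 (by rw [dist_comm, hxy]))
    (Metric.mem_closedBall_self Metric.infDist_nonneg)
  rw [← dist_eq_norm x y, ← hxy] at hmv
  linarith [hb y hy, (le_abs_self _).trans hmv]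

variable {N : ℕ} {Ω : Opens (RN N)} {Λ : ℝ}

theorem IsPrimalAdmissible.abs_le {u : RN N → ℝ} (hu : IsPrimalAdmissible Ω Λ u)
    (hΩ : (Ω : Set (RN N)) ≠ Set.univ) {x : RN N} (hx : x ∈ closure (Ω : Set (RN N))) :
    |u x| ≤ Λ * Metric.infDist x (Ω : Set (RN N))ᶜ := by
  obtain ⟨C, hC⟩ := hu.lipschitz
  obtain ⟨y, hy, hxy, -⟩ := exists_mem_frontier_closedBall_subset_closure hΩ hx
  rcases eq_or_ne (Metric.infDist x (Ω : Set (RN N))ᶜ) 0 with hr | hr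
  · obtain rfl : x = y := dist_eq_zero.1 (hxy.symm.trans hr)
    rw [hu.boundary x hy, hr, mul_zero, abs_zero]
  have hball : Metric.ball x (Metric.infDist x (Ω : Set (RN N))ᶜ) ⊆ Ω :=
    Metric.ball_infDist_compl_subset
  have hinterior : ∀ z ∈ Metric.ball x (Metric.infDist x (Ω : Set (RN N))ᶜ),
      |u z - u x| ≤ Λ * ‖z - x‖ := fun z hz =>
    abs_sub_le_of_ae_norm_fderiv_le (μ := volume) Metric.isOpen_ball (convex_ball _ _)
      (hC.mono (hball.trans subset_closure))
      (by
        filter_upwards [(ae_restrict_iff' Ω.isOpen.measurableSet).1 hu.gradient_le] with w hw hwb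
        rw [← norm_gradient_eq_norm_fderiv]
        exact hw (hball hwb))
      (Metric.mem_ball_self (Metric.infDist_nonneg.lt_of_ne' hr)) hz
  have hyball : y ∈ closure (Metric.ball x (Metric.infDist x (Ω : Set (RN N))ᶜ)) := by
    rw [closure_ball x hr, Metric.mem_closedBall, dist_comm, hxy]
  have huy : ContinuousWithinAt u (Metric.ball x (Metric.infDist x (Ω : Set (RN N))ᶜ)) y :=
    (hC.continuousOn y (frontier_subset_closure hy)).mono (hball.trans subset_closure)
  have hbound : |u y - u x| ≤ Λ * ‖y - x‖ :=
    (huy.sub continuousWithinAt_const).abs.closure_le hyball (by fun_prop) hinterior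
  rwa [hu.boundary y hy, zero_sub, abs_neg, ← dist_eq_norm, dist_comm, ← hxy] at hbound

theorem isPrimalAdmissible_infDist_compl (Ω : Opens (RN N)) (hΛ : 0 ≤ Λ) :
    IsPrimalAdmissible Ω Λ fun x => Λ * Metric.infDist x (Ω : Set (RN N))ᶜ := by
  have hlip : LipschitzWith Λ.toNNReal fun x => Λ * Metric.infDist x (Ω : Set (RN N))ᶜ := by
    have hd := (lipschitzWith_smul Λ).comp (Metric.lipschitz_infDist_pt (Ω : Set (RN N))ᶜ)
    rwa [mul_one, ← Real.toNNReal_eq_nnnorm_of_nonneg hΛ] at hd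
  refine ⟨⟨_, hlip.lipschitzOnWith⟩, fun x hx => ?_, ae_restrict_of_ae ?_⟩
  · rw [Ω.isOpen.frontier_eq] at hx
    rw [Metric.infDist_zero_of_mem hx.2, mul_zero]
  · filter_upwards [hlip.ae_differentiableAt] with x hx
    refine ⟨hx, ?_⟩
    rw [norm_gradient_eq_norm_fderiv]
    exact (norm_fderiv_le_of_lipschitz ℝ hlip).trans_eq (Real.coe_toNNReal Λ hΛ)

end DistanceToComplement

section Mollification

variable {E : Type*} [NormedAddCommGroup E] [NormedSpace ℝ E] [FiniteDimensional ℝ E]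

theorem lipschitzWith_normed_convolution [MeasurableSpace E] [BorelSpace E] (μ : Measure E)
    [μ.IsAddHaarMeasure] (ρ : ContDiffBump (0 : E)) {C : NNReal} {w : E → ℝ}
    (hw : LipschitzWith C w) :
    LipschitzWith C (convolution (ρ.normed μ) w (ContinuousLinearMap.lsmul ℝ ℝ) μ) := by
  have hint : ∀ x, Integrable (fun t => ρ.normed μ t • w (x - t)) μ := fun x =>
    ((ρ.continuous_normed.smul
      (hw.continuous.comp (continuous_const.sub continuous_id))).integrable_of_hasCompactSupport
        ρ.hasCompactSupport_normed.smul_right)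
  refine LipschitzWith.of_dist_le_mul fun x y => ?_
  calc dist (∫ t, ρ.normed μ t • w (x - t) ∂μ) (∫ t, ρ.normed μ t • w (y - t) ∂μ)
      = ‖∫ t, ρ.normed μ t • (w (x - t) - w (y - t)) ∂μ‖ := by
        rw [dist_eq_norm, ← integral_sub (hint x) (hint y)]
        simp_rw [smul_sub]
    _ ≤ ∫ t, ρ.normed μ t * (C * dist x y) ∂μ := by
        refine norm_integral_le_of_norm_le (ρ.integrable_normed.mul_const _)
          (ae_of_all _ fun t => ?_)
        rw [norm_smul, Real.norm_of_nonneg (ρ.nonneg_normed t), ← dist_eq_norm,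
          ← dist_sub_right x y t]
        exact mul_le_mul_of_nonneg_left (hw.dist_le_mul _ _) (ρ.nonneg_normed t)
    _ = C * dist x y := by rw [integral_mul_const, ρ.integral_normed, one_mul]

theorem exists_testFunction_of_lipschitzWith {Ω : Opens E} {C : NNReal} {w : E → ℝ}
    (hw : LipschitzWith C w) (hc : HasCompactSupport w) (hs : tsupport w ⊆ Ω) {ε : ℝ}
    (hε : 0 < ε) :
    ∃ φ : 𝓓(Ω, ℝ), (∀ x, ‖fderiv ℝ φ x‖ ≤ C) ∧ ∀ x, |φ x - w x| ≤ ε := by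
  have := FiniteDimensional.proper_real E
  borelize E
  let μ : Measure E := Measure.addHaar
  obtain ⟨δ, hδ, hδΩ⟩ := hc.isCompact.exists_cthickening_subset_open Ω.isOpen hs
  obtain ⟨η, hη, hηε⟩ := Metric.uniformContinuous_iff.1 hw.uniformContinuous ε hε
  have hr : 0 < min δ η := lt_min hδ hη
  let ρ : ContDiffBump (0 : E) := ⟨min δ η / 2, min δ η, half_pos hr, half_lt_self hr⟩
  let g : E → ℝ := convolution (ρ.normed μ) w (ContinuousLinearMap.lsmul ℝ ℝ) μ
  have hsmooth : ContDiff ℝ (⊤ : ℕ∞) g :=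
    ρ.hasCompactSupport_normed.contDiff_convolution_left _ ρ.contDiff_normed
      hw.continuous.locallyIntegrable
  have hsupp : tsupport g ⊆ Metric.cthickening δ (tsupport w) := by
    refine closure_minimal (fun x hx => ?_) Metric.isClosed_cthickening
    obtain ⟨a, ha, b, hb, rfl⟩ := support_convolution_subset _ hx
    rw [ρ.support_normed_eq, mem_ball_zero_iff] at ha
    refine Metric.mem_cthickening_of_dist_le _ b _ _ (subset_tsupport _ hb) ?_
    rw [dist_add_self_left]
    exact ha.le.trans (min_le_left _ _)
  refine ⟨⟨g, hsmooth, hc.isCompact.cthickening.of_isClosed_subset (isClosed_tsupport _) hsupp,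
    hsupp.trans hδΩ⟩, fun x => norm_fderiv_le_of_lipschitz ℝ
      (lipschitzWith_normed_convolution μ ρ hw), fun x => ?_⟩
  exact ρ.dist_normed_convolution_le hw.continuous.aestronglyMeasurable fun y hy =>
    (hηε (hy.trans_le (min_le_right _ _))).le

theorem hasCompactSupport_infDist_compl {s : Set E} (hs : Bornology.IsBounded s) :
    HasCompactSupport fun x => Metric.infDist x sᶜ := by
  have := FiniteDimensional.proper_real E
  exact .intro hs.isCompact_closure fun x hx =>
    Metric.infDist_zero_of_mem fun h => hx (subset_closure h)

theorem exists_testFunction_near_infDist_compl {Ω : Opens E}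
    (hΩ : Bornology.IsBounded (Ω : Set E)) {ε : ℝ} (hε : 0 < ε) :
    ∃ φ : 𝓓(Ω, ℝ), (∀ x, ‖fderiv ℝ φ x‖ ≤ 1) ∧
      ∀ x, |φ x - Metric.infDist x (Ω : Set E)ᶜ| ≤ ε := by
  let d : E → ℝ := fun x => Metric.infDist x (Ω : Set E)ᶜ
  have hd : Continuous d := Metric.continuous_infDist_pt _
  let w : E → ℝ := fun x => max (d x - ε / 2) 0
  have hlip : LipschitzWith 1 w := by
    simpa using ((Metric.lipschitz_infDist_pt (Ω : Set E)ᶜ).sub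
      (LipschitzWith.const (ε / 2))).max_const 0
  have hsub : tsupport w ⊆ {x | ε / 2 ≤ d x} :=
    closure_minimal (fun x hx => le_of_not_ge fun h => hx (max_eq_right (sub_nonpos.2 h)))
      (isClosed_le continuous_const hd)
  have hd0 : ∀ x ∈ tsupport w, d x ≠ 0 := fun x hx => ((half_pos hε).trans_le (hsub hx)).ne'
  have hsubΩ : tsupport w ⊆ Ω := fun x hx =>
    by_contra fun h => hd0 x hx (Metric.infDist_zero_of_mem h)
  have hcomp : HasCompactSupport w :=
    (hasCompactSupport_infDist_compl hΩ).isCompact.of_isClosed_subset (isClosed_tsupport _)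
      fun x hx => subset_tsupport _ (hd0 x hx)
  obtain ⟨φ, hφ, hφw⟩ := exists_testFunction_of_lipschitzWith hlip hcomp hsubΩ (half_pos hε)
  have hwd : ∀ x, |w x - d x| ≤ ε / 2 := fun x => by
    have hdx : 0 ≤ d x := Metric.infDist_nonneg
    refine abs_le.2 ⟨?_, ?_⟩
    · linarith [le_max_left (d x - ε / 2) 0]
    · exact sub_le_iff_le_add'.2 (max_le (by linarith) (by linarith))
  refine ⟨φ, hφ, fun x => (abs_sub_le _ (w x) _).trans ?_⟩
  linarith [hφw x, hwd x]

end Mollification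

section WeakDuality

variable {N : ℕ} {Ω : Opens (RN N)} {f ν : Measure (RN N)} {σ : VectorMeasure (RN N) (RN N)}

theorem integrable_infDist_compl {s : Set (RN N)} (hs : Bornology.IsBounded s)
    (μ : Measure (RN N)) [IsFiniteMeasureOnCompacts μ] :
    Integrable (fun x => Metric.infDist x sᶜ) μ :=
  (Metric.continuous_infDist_pt _).integrable_of_hasCompactSupport
    (hasCompactSupport_infDist_compl hs)

theorem integral_infDist_compl_le_variation (hΩ : Bornology.IsBounded (Ω : Set (RN N)))
    [IsFiniteMeasure f] (hσ : IsBoundedVectorMeasure σ)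
    (hdiv : ∀ φ : 𝓓(Ω, ℝ), gradPairing σ φ = ∫ x, φ x ∂f) :
    ∫ x, Metric.infDist x (Ω : Set (RN N))ᶜ ∂f ≤ σ.variation.real Set.univ := by
  have happrox : ∀ ε > 0, ∫ x, Metric.infDist x (Ω : Set (RN N))ᶜ ∂f ≤
      σ.variation.real Set.univ + f.real Set.univ * ε := fun ε hε => by
    obtain ⟨φ, hφ, hφd⟩ := exists_testFunction_near_infDist_compl hΩ hε
    calc ∫ x, Metric.infDist x (Ω : Set (RN N))ᶜ ∂f ≤ ∫ x, (φ x + ε) ∂f :=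
          integral_mono (integrable_infDist_compl hΩ f)
            ((integrable_testFunction φ f).add (integrable_const ε))
            fun x => by linarith [(abs_le.1 (hφd x)).1]
      _ = gradPairing σ φ + f.real Set.univ * ε := by
          rw [integral_add (integrable_testFunction φ f) (integrable_const ε), integral_const,
            smul_eq_mul, hdiv]
      _ ≤ σ.variation.real Set.univ + f.real Set.univ * ε := by
          gcongr
          rw [← one_mul (σ.variation.real Set.univ)]
          exact (le_abs_self _).trans
            (abs_gradPairing_le hσ fun x => (norm_gradient_eq_norm_fderiv φ x).trans_le (hφ x))
  have hlim : Tendsto (fun ε => σ.variation.real Set.univ + f.real Set.univ * ε) (𝓝[>] 0)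
      (𝓝 (σ.variation.real Set.univ)) :=
    (Continuous.tendsto' (by fun_prop) _ _ (by simp)).mono_left nhdsWithin_le_nhds
  exact ge_of_tendsto hlim (by filter_upwards [self_mem_nhdsWithin] using happrox)

theorem gradPairing_eq_integral_of_measure_compl_frontier (hν : ν (frontier (Ω : Set (RN N)))ᶜ = 0)
    (hdiv : ∀ φ : 𝓓((⊤ : Opens (RN N)), ℝ), gradPairing σ φ = ∫ x, φ x ∂f - ∫ x, φ x ∂ν)
    (φ : 𝓓(Ω, ℝ)) : gradPairing σ φ = ∫ x, φ x ∂f := by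
  have hφν : ∫ x, φ x ∂ν = 0 := by
    refine integral_eq_zero_of_ae ?_
    filter_upwards [mem_ae_iff.2 hν] with x hx
    rw [Ω.isOpen.frontier_eq] at hx
    exact image_eq_zero_of_notMem_tsupport fun h => hx.2 (φ.tsupport_subset h)
  have hφ := hdiv ⟨φ, φ.contDiff, φ.hasCompactSupport, Set.subset_univ _⟩
  exact hφ.trans (sub_eq_self.2 hφν)

end WeakDuality

section OptimalBoundaryMeasure

variable {N : ℕ} {f ν : Measure (RN N)} {σ : VectorMeasure (RN N) (RN N)}

theorem exists_testFunction_eventuallyEq_one {K : Set (RN N)} (hK : Bornology.IsBounded K) :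
    ∃ φ : 𝓓((⊤ : Opens (RN N)), ℝ), ∀ x ∈ K, φ =ᶠ[𝓝 x] 1 := by
  obtain ⟨R, hR, hKR⟩ := hK.subset_ball_lt 0 (0 : RN N)
  let b : ContDiffBump (0 : RN N) := ⟨R, R + 1, hR, lt_add_one R⟩
  exact ⟨⟨b, b.contDiff, b.hasCompactSupport, Set.subset_univ _⟩,
    fun x hx => b.eventuallyEq_one_of_mem_ball (hKR hx)⟩

theorem measureReal_univ_eq_of_gradPairing [IsFiniteMeasure f] [IsFiniteMeasure ν]
    {K : Set (RN N)} (hK : Bornology.IsBounded K) (hσ : σ.variation Kᶜ = 0) (hf : f Kᶜ = 0)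
    (hν : ν Kᶜ = 0)
    (hdiv : ∀ φ : 𝓓((⊤ : Opens (RN N)), ℝ), gradPairing σ φ = ∫ x, φ x ∂f - ∫ x, φ x ∂ν) :
    f.real Set.univ = ν.real Set.univ := by
  obtain ⟨φ, hφ⟩ := exists_testFunction_eventuallyEq_one hK
  have hmass : ∀ (μ : Measure (RN N)), μ Kᶜ = 0 → ∫ x, φ x ∂μ = μ.real Set.univ := fun μ hμ => by
    have hφμ : ∀ᵐ x ∂μ, φ x = 1 := by
      filter_upwards [mem_ae_iff.2 hμ] with x hx
      exact (hφ x hx).eq_of_nhds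
    simp [integral_congr_ae hφμ]
  have hgrad : gradPairing σ φ = 0 := by
    refine VectorMeasure.integral_eq_zero_of_ae ?_
    filter_upwards [mem_ae_iff.2 hσ] with x hx
    rw [gradient, (hφ x hx).fderiv_eq]
    simp
  rw [← hmass f hf, ← hmass ν hν]
  exact sub_eq_zero.1 ((hdiv φ).symm.trans hgrad)

theorem exists_boundaryProbability_gradPairing_eq {Ω : Opens (RN N)}
    (hΩ : Bornology.IsBounded (Ω : Set (RN N))) (hΩ' : (Ω : Set (RN N)) ≠ Set.univ)
    [IsProbabilityMeasure f] (hf : f (closure (Ω : Set (RN N)))ᶜ = 0) :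
    ∃ (ν : Measure (RN N)) (σ : VectorMeasure (RN N) (RN N)), IsBoundaryProbability Ω ν ∧
      IsBoundedVectorMeasure σ ∧ σ.variation (closure (Ω : Set (RN N)))ᶜ = 0 ∧
      σ.variation.real Set.univ ≤ ∫ x, Metric.infDist x (Ω : Set (RN N))ᶜ ∂f ∧
      ∀ φ : 𝓓((⊤ : Opens (RN N)), ℝ), gradPairing σ φ = ∫ x, φ x ∂f - ∫ x, φ x ∂ν := by
  have hd := integrable_infDist_compl hΩ f
  obtain ⟨σ, ν, hσ, hσD, hσΩ, hν, -, hνΩ, hσν⟩ := exists_gradPairing_add_integral_eq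
    (D := ∫ x, Metric.infDist x (Ω : Set (RN N))ᶜ ∂f) isClosed_closure
    (isClosed_frontier (s := (Ω : Set (RN N)))) (integralLinearForm f)
    (integral_nonneg fun _ => Metric.infDist_nonneg) zero_le_one fun φ a b _ _ ha hb => by
      calc ∫ x, φ x ∂f ≤ ∫ x, (a * Metric.infDist x (Ω : Set (RN N))ᶜ + b) ∂f := by
            refine integral_mono_ae (integrable_testFunction φ f)
              ((hd.const_mul a).add (integrable_const b)) ?_
            filter_upwards [mem_ae_iff.2 hf] with x hx
            exact le_mul_infDist_compl_add hΩ' (φ.contDiff.differentiable (by simp)) ha hb hx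
        _ = (∫ x, Metric.infDist x (Ω : Set (RN N))ᶜ ∂f) * a + 1 * b := by
            rw [integral_add (hd.const_mul a) (integrable_const b), integral_const_mul,
              integral_const, probReal_univ, one_smul, one_mul, mul_comm]
  have hdiv : ∀ φ : 𝓓((⊤ : Opens (RN N)), ℝ),
      gradPairing σ φ = ∫ x, φ x ∂f - ∫ x, φ x ∂ν := fun φ => eq_sub_of_add_eq (hσν φ).symm
  have hmass := measureReal_univ_eq_of_gradPairing hΩ.closure hσΩ hf
    (measure_mono_null (Set.compl_subset_compl.2 frontier_subset_closure) hνΩ) hdiv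
  rw [probReal_univ] at hmass
  exact ⟨ν, σ, ⟨isProbabilityMeasure_iff_real.2 hmass.symm, hνΩ⟩, hσ, hσΩ, hσD, hdiv⟩

end OptimalBoundaryMeasure

section StrongDuality

variable {N : ℕ} {Ω : Opens (RN N)} {f ν : Measure (RN N)} {Λ : ℝ}

theorem integral_toSignedMeasure_sub [IsFiniteMeasure f] [IsFiniteMeasure ν] {φ : RN N → ℝ}
    (hf : Integrable φ f) (hν : Integrable φ ν) :
    ∫ᵛ x, φ x ∂•(f.toSignedMeasure - ν.toSignedMeasure) = ∫ x, φ x ∂f - ∫ x, φ x ∂ν := by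
  have hflip : (ContinuousLinearMap.lsmul ℝ ℝ : ℝ →L[ℝ] ℝ →L[ℝ] ℝ) =
      (ContinuousLinearMap.lsmul ℝ ℝ : ℝ →L[ℝ] ℝ →L[ℝ] ℝ).flip := by
    ext
    simp
  rw [hflip, VectorMeasure.integral_sub_vectorMeasure, VectorMeasure.integral_toSignedMeasure,
    VectorMeasure.integral_toSignedMeasure]
  · simpa [VectorMeasure.Integrable] using hf
  · simpa [VectorMeasure.Integrable] using hν

theorem isLeast_primalValues (hΩ : Bornology.IsBounded (Ω : Set (RN N)))
    (hΩ' : (Ω : Set (RN N)) ≠ Set.univ) [IsFiniteMeasureOnCompacts f]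
    (hf : f (closure (Ω : Set (RN N)))ᶜ = 0) (hΛ : 0 ≤ Λ) :
    IsLeast (primalValues Ω f Λ) (-(Λ * ∫ x, Metric.infDist x (Ω : Set (RN N))ᶜ ∂f)) := by
  have hd := (integrable_infDist_compl hΩ f).const_mul Λ
  have hrestrict : f.restrict (closure (Ω : Set (RN N))) = f :=
    Measure.restrict_eq_self_of_ae_mem (mem_ae_iff.2 hf)
  refine ⟨⟨_, isPrimalAdmissible_infDist_compl Ω hΛ, by rw [hrestrict, integral_const_mul]⟩, ?_⟩
  rintro _ ⟨u, hu, rfl⟩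
  rw [← integral_const_mul, neg_le_neg_iff]
  obtain ⟨C, hC⟩ := hu.lipschitz
  calc ∫ x in closure (Ω : Set (RN N)), u x ∂f
      ≤ ∫ x in closure (Ω : Set (RN N)), Λ * Metric.infDist x (Ω : Set (RN N))ᶜ ∂f :=
        setIntegral_mono_on (hC.continuousOn.integrableOn_compact hΩ.isCompact_closure)
          hd.integrableOn isClosed_closure.measurableSet
          fun x hx => (le_abs_self _).trans (hu.abs_le hΩ' hx)
    _ = ∫ x, Λ * Metric.infDist x (Ω : Set (RN N))ᶜ ∂f := by rw [hrestrict]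

theorem isLeast_dualMinima (hΩ : Bornology.IsBounded (Ω : Set (RN N)))
    (hΩ' : (Ω : Set (RN N)) ≠ Set.univ) [IsProbabilityMeasure f]
    (hf : f (closure (Ω : Set (RN N)))ᶜ = 0) (hΛ : 0 ≤ Λ) :
    IsLeast (dualMinima Ω f Λ) (Λ * ∫ x, Metric.infDist x (Ω : Set (RN N))ᶜ ∂f) := by
  have hlower : ∀ ν, IsBoundaryProbability Ω ν → ∀ m ∈ dualValues f Λ ν,
      Λ * ∫ x, Metric.infDist x (Ω : Set (RN N))ᶜ ∂f ≤ m := by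
    rintro ν hν _ ⟨σ, hσ, hdiv, rfl⟩
    exact mul_le_mul_of_nonneg_left (integral_infDist_compl_le_variation hΩ hσ
      (gradPairing_eq_integral_of_measure_compl_frontier hν.2 hdiv)) hΛ
  obtain ⟨ν, σ, hν, hσ, -, hσd, hdiv⟩ := exists_boundaryProbability_gradPairing_eq hΩ hΩ' hf
  have hσν : Λ * σ.variation.real Set.univ ∈ dualValues f Λ ν := ⟨σ, hσ, hdiv, rfl⟩
  refine ⟨⟨ν, hν, ?_, hlower ν hν⟩, fun m ⟨ν', hν', hm⟩ => hlower ν' hν' m hm.1⟩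
  rwa [(hlower ν hν _ hσν).antisymm (mul_le_mul_of_nonneg_left hσd hΛ)]

theorem isLeast_dualSupportedValues (hΩ : Bornology.IsBounded (Ω : Set (RN N)))
    (hΩ' : (Ω : Set (RN N)) ≠ Set.univ) [IsProbabilityMeasure f]
    (hf : f (closure (Ω : Set (RN N)))ᶜ = 0) (hΛ : 0 ≤ Λ) :
    IsLeast (dualSupportedValues Ω f Λ) (Λ * ∫ x, Metric.infDist x (Ω : Set (RN N))ᶜ ∂f) := by
  have hmass : ∀ σ : VectorMeasure (RN N) (RN N), σ.variation (closure (Ω : Set (RN N)))ᶜ = 0 →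
      σ.variation.real (closure (Ω : Set (RN N))) = σ.variation.real Set.univ := fun σ hσ =>
    measureReal_congr (eventuallyEq_univ.2 (mem_ae_iff.2 hσ))
  obtain ⟨ν, σ, ⟨_, hν⟩, hσ, hσΩ, hσd, hdiv⟩ :=
    exists_boundaryProbability_gradPairing_eq hΩ hΩ' hf
  have hdivΩ := gradPairing_eq_integral_of_measure_compl_frontier hν hdiv
  refine ⟨⟨σ, hσ, Measure.support_subset_of_isClosed isClosed_closure (mem_ae_iff.2 hσΩ),
    ⟨f.toSignedMeasure - ν.toSignedMeasure, fun φ => ?_⟩, hdivΩ, ?_⟩, ?_⟩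
  · rw [hdiv, integral_toSignedMeasure_sub (integrable_testFunction φ f)
      (integrable_testFunction φ ν)]
  · rw [hmass σ hσΩ, hσd.antisymm (integral_infDist_compl_le_variation hΩ hσ hdivΩ)]
  · rintro _ ⟨σ', hσ', hsupp, -, hdiv', rfl⟩
    rw [hmass σ' (measure_mono_null (Set.compl_subset_compl.2 hsupp)
      Measure.measure_compl_support)]
    exact mul_le_mul_of_nonneg_left (integral_infDist_compl_le_variation hΩ hσ' hdiv') hΛ

end StrongDuality

section Lebesgue

variable {X : Type*} [MeasurableSpace X] {μ : Measure X}

theorem lintegral_rpow_le_lintegral_rpow_mul_lintegral_rpow {f : X → ENNReal}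
    (hf : AEMeasurable f μ) {a b c : ℝ} (ha : 0 ≤ a) (hab : a < b) (hbc : b < c) :
    (∫⁻ x, f x ^ b ∂μ) ^ (c - a) ≤ (∫⁻ x, f x ^ a ∂μ) ^ (c - b) * (∫⁻ x, f x ^ c ∂μ) ^ (b - a) := by
  have hca : 0 < c - a := by linarith
  have hb : a * ((c - b) / (c - a)) + c * ((b - a) / (c - a)) = b := by
    field_simp
    ring
  have hHolder := ENNReal.lintegral_mul_norm_pow_le (hf.pow_const a) (hf.pow_const c)
    (p := (c - b) / (c - a)) (q := (b - a) / (c - a)) (div_nonneg (by linarith) hca.le)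
    (div_nonneg (by linarith) hca.le) (by field_simp; ring)
  simp only [← ENNReal.rpow_mul] at hHolder
  rw [← ENNReal.le_rpow_inv_iff hca, ENNReal.mul_rpow_of_nonneg _ _ (inv_nonneg.2 hca.le),
    ← ENNReal.rpow_mul, ← ENNReal.rpow_mul, ← div_eq_mul_inv, ← div_eq_mul_inv]
  refine le_trans (le_of_eq (lintegral_congr fun x => ?_)) hHolder
  rw [← ENNReal.rpow_add_of_nonneg _ _ (mul_nonneg ha (div_nonneg (by linarith) hca.le))
    (mul_nonneg (by linarith) (div_nonneg (by linarith) hca.le)), hb]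

theorem tendsto_eLpNorm_of_tendsto_eLpNorm_sub {ι E : Type*} [NormedAddCommGroup E] {l : Filter ι}
    {p : ENNReal} (hp : 1 ≤ p) {f : ι → X → E} {g : X → E}
    (hf : ∀ i, AEStronglyMeasurable (f i) μ) (hg : AEStronglyMeasurable g μ)
    (hfg : Tendsto (fun i => eLpNorm (fun x => f i x - g x) p μ) l (𝓝 0)) :
    Tendsto (fun i => eLpNorm (f i) p μ) l (𝓝 (eLpNorm g p μ)) := by
  have hlower := ENNReal.Tendsto.sub (tendsto_const_nhds (x := eLpNorm g p μ)) hfg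
    (Or.inr ENNReal.zero_ne_top)
  have hupper := (tendsto_const_nhds (x := eLpNorm g p μ)).add hfg
  rw [tsub_zero] at hlower
  rw [add_zero] at hupper
  refine tendsto_of_tendsto_of_tendsto_of_le_of_le hlower hupper (fun i => ?_) fun i => ?_
  · rw [tsub_le_iff_right]
    simpa using! eLpNorm_sub_le (hf i) ((hf i).sub hg) hp
  · simpa using! eLpNorm_add_le hg ((hf i).sub hg) hp

theorem eLpNorm_le_of_tendsto_eLpNorm_sub {ι E : Type*} [NormedAddCommGroup E] {l : Filter ι}
    [l.NeBot] [l.IsCountablyGenerated] {p q : ENNReal} (hp : p ≠ 0) {f : ι → X → E} {g : X → E}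
    (hf : ∀ i, AEStronglyMeasurable (f i) μ) (hg : AEStronglyMeasurable g μ)
    (hfg : Tendsto (fun i => eLpNorm (fun x => f i x - g x) p μ) l (𝓝 0))
    {B : ι → ENNReal} {b : ENNReal} (hB : Tendsto B l (𝓝 b))
    (hfB : ∀ i, eLpNorm (f i) q μ ≤ B i) : eLpNorm g q μ ≤ b := by
  refine le_of_forall_gt_imp_ge_of_dense fun c hc => eLpNorm_le_of_tendstoInMeasure ?_
    (tendstoInMeasure_of_tendsto_eLpNorm hp hf hg hfg) hf
  filter_upwards [hB.eventually_le_const hc] with i hi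
  exact (hfB i).trans hi

end Lebesgue

section Sobolev

/-- The Gagliardo–Nirenberg–Sobolev inequality `‖v‖_{L^κ(s)} ≤ C ‖∇v‖_{L¹}` for compactly supported
`v` of class `C¹`. The norm of `v` is taken on `s` only, so that in dimension one, where `v` is
controlled in `L^∞`, a finite exponent `κ` can be used on bounded sets. -/
def HasSobolevInequality {E : Type*} [NormedAddCommGroup E] [NormedSpace ℝ E] [MeasureSpace E]
    (s : Set E) (κ C : NNReal) : Prop :=
  ∀ v : E → ℝ, ContDiff ℝ 1 v → HasCompactSupport v →
    eLpNorm v κ (volume.restrict s) ≤ C * eLpNorm (fderiv ℝ v) 1 volume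

variable {E : Type*} [NormedAddCommGroup E] [InnerProductSpace ℝ E] [FiniteDimensional ℝ E]
  [MeasurableSpace E] [BorelSpace E]

theorem enorm_le_lintegral_fderiv_of_finrank_eq_one (hE : Module.finrank ℝ E = 1) {v : E → ℝ}
    (hv : ContDiff ℝ 1 v) (hc : HasCompactSupport v) (x : E) :
    ‖v x‖ₑ ≤ ∫⁻ y, ‖fderiv ℝ v y‖ₑ := by
  let e : ℝ ≃ₗᵢ[ℝ] E := (stdOrthonormalBasis ℝ ℝ).equiv (stdOrthonormalBasis ℝ E)
    (finCongr (by rw [hE, Module.finrank_self]))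
  have hderiv : ∀ t, ‖deriv (v ∘ e) t‖ₑ ≤ ‖fderiv ℝ v (e t)‖ₑ := fun t => by
    have he : HasDerivAt e (e 1) t := e.toContinuousLinearEquiv.hasFDerivAt.hasDerivAt
    rw [((hv.differentiable one_ne_zero) (e t)).hasFDerivAt.comp_hasDerivAt t he |>.deriv]
    simpa using (fderiv ℝ v (e t)).le_opENorm (e 1)
  calc ‖v x‖ₑ = ‖(v ∘ e) (e.symm x)‖ₑ := by simp
    _ ≤ ∫⁻ t in Set.Iic (e.symm x), ‖deriv (v ∘ e) t‖ₑ :=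
        HasCompactSupport.enorm_le_lintegral_Ici_deriv (hv.comp e.contDiff)
          (hc.comp_homeomorph e.toHomeomorph) _
    _ ≤ ∫⁻ t, ‖fderiv ℝ v (e t)‖ₑ :=
        (setLIntegral_le_lintegral _ _).trans (lintegral_mono hderiv)
    _ = ∫⁻ y, ‖fderiv ℝ v y‖ₑ :=
        e.measurePreserving.lintegral_comp (measurable_fderiv ℝ v).enorm

theorem exists_hasSobolevInequality (hE : 0 < Module.finrank ℝ E) {s : Set E}
    (hs : Bornology.IsBounded s) :
    ∃ κ C : NNReal, 1 < κ ∧ HasSobolevInequality s κ C := by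
  obtain hE | hE := (Nat.succ_le_of_lt hE).eq_or_lt
  · refine ⟨2, (volume s ^ (2⁻¹ : ℝ)).toNNReal, one_lt_two, fun v hv hc => ?_⟩
    have hle := eLpNorm_le_of_ae_enorm_bound (μ := volume.restrict s) (p := 2) (ae_of_all _
      (enorm_le_lintegral_fderiv_of_finrank_eq_one hE.symm hv hc))
    rw [ENNReal.coe_toNNReal (by finiteness [(hs.measure_lt_top (μ := volume)).ne]),
      eLpNorm_one_eq_lintegral_enorm]
    simpa [mul_comm] using! hle
  · have hconj := NNReal.HolderConjugate.conjExponent (p := Module.finrank ℝ E)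
      (by exact_mod_cast hE)
    exact ⟨_, _, hconj.symm.lt, fun v hv hc => (eLpNorm_restrict_le _ _ _ _).trans
      (eLpNorm_le_eLpNorm_fderiv_one volume hv hc hconj)⟩

theorem eLpNorm_fderiv_norm_rpow_le (μ : Measure E) {p : ℝ} (hp : 1 < p) {v : E → ℝ}
    (hv : ContDiff ℝ 1 v) :
    eLpNorm (fderiv ℝ fun x => ‖v x‖ ^ p) 1 μ ≤ ENNReal.ofReal p *
      eLpNorm v (ENNReal.ofReal p) μ ^ (p - 1) *
      eLpNorm (fderiv ℝ v) (ENNReal.ofReal p) μ := by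
  have hconj := Real.HolderConjugate.conjExponent hp
  have hp1 : 0 < p - 1 := sub_pos.2 hp
  have := hconj.symm.ennrealOfReal
  have hpow : eLpNorm (fun x => ‖v x‖ ^ (p - 1)) (ENNReal.ofReal p.conjExponent) μ =
      eLpNorm v (ENNReal.ofReal p) μ ^ (p - 1) := by
    rw [eLpNorm_norm_rpow v hp1, ← ENNReal.ofReal_mul hconj.symm.nonneg, Real.conjExponent,
      div_mul_cancel₀ _ hp1.ne']
  calc eLpNorm (fderiv ℝ fun x => ‖v x‖ ^ p) 1 μ
      ≤ eLpNorm (fun x => p * ‖v x‖ ^ (p - 1) * ‖fderiv ℝ v x‖) 1 μ :=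
        eLpNorm_mono_real fun x => norm_fderiv_norm_rpow_le (hv.differentiable one_ne_zero) hp
    _ ≤ p.toNNReal * eLpNorm (fun x => ‖v x‖ ^ (p - 1)) (ENNReal.ofReal p.conjExponent) μ *
          eLpNorm (fderiv ℝ v) (ENNReal.ofReal p) μ := by
        refine eLpNorm_le_eLpNorm_mul_eLpNorm'_of_norm
          (hv.continuous.norm.rpow_const fun _ => Or.inr hp1.le).aestronglyMeasurable
          (hv.continuous_fderiv one_ne_zero).aestronglyMeasurable
          (fun a L => p * a * ‖L‖) _ (ae_of_all _ fun x => ?_)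
        simp [abs_of_pos hconj.pos, hconj.nonneg]
    _ = _ := by rw [hpow]; rfl

theorem HasSobolevInequality.eLpNorm_rpow_le {s : Set E} {κ C : NNReal}
    (h : HasSobolevInequality s κ C) {p : ℝ} (hp : 1 < p) {v : E → ℝ} (hv : ContDiff ℝ 1 v)
    (hc : HasCompactSupport v) :
    eLpNorm v (κ * ENNReal.ofReal p) (volume.restrict s) ^ p ≤ C * (ENNReal.ofReal p *
      eLpNorm v (ENNReal.ofReal p) volume ^ (p - 1) *
      eLpNorm (fderiv ℝ v) (ENNReal.ofReal p) volume) := by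
  rw [← eLpNorm_norm_rpow v (zero_lt_one.trans hp)]
  refine (h _ (hv.norm_rpow hp) (hc.comp_left (g := fun t : ℝ => ‖t‖ ^ p) ?_)).trans ?_
  · simp [(zero_lt_one.trans hp).ne']
  · gcongr
    exact eLpNorm_fderiv_norm_rpow_le volume hp hv

end Sobolev

section DualityMap

variable {X : Type*} [MeasurableSpace X] {μ : Measure X} {E : Type*} [NormedAddCommGroup E]

theorem norm_rpow_sub_two_smul_self [NormedSpace ℝ E] {p : ℝ} (hp : p ≠ 1) (x : E) :
    ‖‖x‖ ^ (p - 2) • x‖ = ‖x‖ ^ (p - 1) := by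
  rw [norm_smul, Real.norm_of_nonneg (by positivity)]
  obtain hx | hx := (norm_nonneg x).eq_or_lt
  · rw [← hx, Real.zero_rpow (sub_ne_zero.2 hp), mul_zero]
  · rw [← Real.rpow_add_one hx.ne']
    ring_nf

theorem memLp_norm_rpow_sub_two_smul [NormedSpace ℝ E] {p q : ℝ} (hpq : p.HolderConjugate q)
    {g : X → E} (hg : MemLp g (ENNReal.ofReal p) μ) :
    MemLp (fun x => ‖g x‖ ^ (p - 2) • g x) (ENNReal.ofReal q) μ := by
  refine (memLp_congr_norm ?_ ?_ (g := fun x => ‖g x‖ ^ (p - 1)) (ae_of_all _ fun x => ?_)).2 ?_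
  · exact (hg.1.norm.aemeasurable.pow_const (p - 2)).aestronglyMeasurable.smul hg.1
  · exact (hg.1.norm.aemeasurable.pow_const (p - 1)).aestronglyMeasurable
  · rw [norm_rpow_sub_two_smul_self hpq.lt.ne', Real.norm_of_nonneg (by positivity)]
  · refine ⟨(hg.1.norm.aemeasurable.pow_const (p - 1)).aestronglyMeasurable, ?_⟩
    rw [eLpNorm_norm_rpow g hpq.sub_one_pos, ← ENNReal.ofReal_mul hpq.symm.nonneg, mul_comm,
      hpq.sub_one_mul_conj]
    exact ENNReal.rpow_lt_top_of_nonneg hpq.sub_one_pos.le hg.2.ne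

variable [InnerProductSpace ℝ E]

theorem norm_rpow_sub_two_mul_inner_self {p : ℝ} (hp : p ≠ 0) (x : E) :
    ‖x‖ ^ (p - 2) * ⟪x, x⟫ = ‖x‖ ^ p := by
  rw [real_inner_self_eq_norm_sq, ← Real.rpow_natCast, Nat.cast_ofNat,
    ← Real.rpow_add' (norm_nonneg x) (by simpa using hp), sub_add_cancel]

theorem eLpNorm_one_inner_le {p q : ENNReal} [p.HolderConjugate q] {w v : X → E}
    (hw : AEStronglyMeasurable w μ) (hv : AEStronglyMeasurable v μ) :
    eLpNorm (fun x => ⟪w x, v x⟫) 1 μ ≤ eLpNorm w p μ * eLpNorm v q μ := by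
  simpa using eLpNorm_le_eLpNorm_mul_eLpNorm'_of_norm (r := 1) (p := p) (q := q) hw hv
    (fun a b => ⟪a, b⟫) 1 (ae_of_all _ fun x => by
      simpa using norm_inner_le_norm (𝕜 := ℝ) (w x) (v x))

theorem tendsto_integral_inner {p q : ENNReal} [p.HolderConjugate q] {ι : Type*} {l : Filter ι}
    {w v : X → E} {h : ι → X → E} (hw : MemLp w p μ) (hv : AEStronglyMeasurable v μ)
    (hh : ∀ i, MemLp (h i) q μ)
    (hlim : Tendsto (fun i => eLpNorm (fun x => h i x - v x) q μ) l (𝓝 0)) :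
    Tendsto (fun i => ∫ x, ⟪w x, h i x⟫ ∂μ) l (𝓝 (∫ x, ⟪w x, v x⟫ ∂μ)) := by
  refine tendsto_integral_of_L1' _ (hw.1.inner hv) (Eventually.of_forall fun i => ?_) ?_
  · exact memLp_one_iff_integrable.1 ⟨hw.1.inner (hh i).1,
      (eLpNorm_one_inner_le hw.1 (hh i).1).trans_lt (ENNReal.mul_lt_top hw.2 (hh i).2)⟩
  · have hbound := ENNReal.Tendsto.const_mul (a := eLpNorm w p μ) hlim (Or.inr hw.2.ne)
    rw [mul_zero] at hbound
    refine tendsto_of_tendsto_of_tendsto_of_le_of_le tendsto_const_nhds hbound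
      (fun _ => zero_le) fun i => ?_
    simpa [Pi.sub_def, inner_sub_right] using! eLpNorm_one_inner_le hw.1 ((hh i).1.sub hv)

theorem tendsto_integral_norm_rpow_sub_two_mul_inner {p : ℝ} (hp : 1 < p) {ι : Type*}
    {l : Filter ι} {g : X → E} {h : ι → X → E} (hg : MemLp g (ENNReal.ofReal p) μ)
    (hh : ∀ i, MemLp (h i) (ENNReal.ofReal p) μ)
    (hlim : Tendsto (fun i => eLpNorm (fun x => h i x - g x) (ENNReal.ofReal p) μ) l (𝓝 0)) :
    Tendsto (fun i => ∫ x, ‖g x‖ ^ (p - 2) * ⟪g x, h i x⟫ ∂μ) l (𝓝 (∫ x, ‖g x‖ ^ p ∂μ)) := by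
  have hpq := Real.HolderConjugate.conjExponent hp
  have := hpq.symm.ennrealOfReal
  simpa only [real_inner_smul_left, norm_rpow_sub_two_mul_inner_self hpq.ne_zero] using
    tendsto_integral_inner (memLp_norm_rpow_sub_two_smul hpq hg) hg.1 hh hlim

end DualityMap

section WeakSolution

variable {N : ℕ} {Ω : Opens (RN N)} {p lam : ℝ} {u : RN N → ℝ} {G : RN N → RN N}

theorem memLp_gradient_testFunction (φ : 𝓓(Ω, ℝ)) (q : ENNReal) (μ : Measure (RN N))
    [IsFiniteMeasureOnCompacts μ] : MemLp (∇ (φ : RN N → ℝ)) q μ :=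
  (continuous_gradient_testFunction φ).memLp_of_hasCompactSupport
    ((φ.hasCompactSupport.fderiv (𝕜 := ℝ)).comp_left (map_zero _))

theorem IsPLaplaceSolution.exists_memW01p_integral_norm_rpow_eq (hp : 1 < p)
    (hu : IsPLaplaceSolution p Ω lam u) :
    ∃ G, MemW01p p Ω u G ∧
      ∫ x in (Ω : Set (RN N)), ‖G x‖ ^ p = lam * ∫ x in (Ω : Set (RN N)), |u x| ^ p := by
  obtain ⟨G, hG, heq⟩ := hu
  obtain ⟨φ, hφ, hgrad⟩ := hG.approx
  have hleft := tendsto_integral_norm_rpow_sub_two_mul_inner hp hG.memLp_grad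
    (fun k => memLp_gradient_testFunction (φ k) _ _) hgrad
  have hright := (tendsto_integral_norm_rpow_sub_two_mul_inner hp hG.memLp
    (fun k => (φ k).continuous.memLp_of_hasCompactSupport (φ k).hasCompactSupport) hφ).const_mul lam
  refine ⟨G, hG, tendsto_nhds_unique hleft (hright.congr fun k => ?_)⟩
  simp only [heq, Real.norm_eq_abs, Real.inner_apply, mul_assoc]

theorem HasSobolevInequality.eLpNorm_testFunction_rpow_le {κ C : NNReal}
    (hC : HasSobolevInequality (Ω : Set (RN N)) κ C) (hp : 1 < p) (φ : 𝓓(Ω, ℝ)) :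
    eLpNorm φ (κ * ENNReal.ofReal p) (volume.restrict Ω) ^ p ≤
      C * (ENNReal.ofReal p * eLpNorm φ (ENNReal.ofReal p) (volume.restrict Ω) ^ (p - 1) *
        eLpNorm (∇ (φ : RN N → ℝ)) (ENNReal.ofReal p) (volume.restrict Ω)) := by
  have hsupp := (subset_tsupport φ).trans φ.tsupport_subset
  have hsupp_fderiv := (support_fderiv_subset ℝ (f := φ)).trans φ.tsupport_subset
  rw [eLpNorm_restrict_eq_of_support_subset (p := ENNReal.ofReal p) hsupp,
    eLpNorm_congr_norm_ae (ae_of_all _ (norm_gradient_eq_norm_fderiv φ)),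
    eLpNorm_restrict_eq_of_support_subset (f := fderiv ℝ φ) hsupp_fderiv]
  exact hC.eLpNorm_rpow_le hp (φ.contDiff.of_le (by exact_mod_cast le_top)) φ.hasCompactSupport

theorem MemW01p.eLpNorm_rpow_le (hu : MemW01p p Ω u G) {κ C : NNReal}
    (hC : HasSobolevInequality (Ω : Set (RN N)) κ C) (hp : 1 < p) :
    eLpNorm u (κ * ENNReal.ofReal p) (volume.restrict Ω) ^ p ≤
      C * (ENNReal.ofReal p * eLpNorm u (ENNReal.ofReal p) (volume.restrict Ω) ^ (p - 1) *
        eLpNorm G (ENNReal.ofReal p) (volume.restrict Ω)) := by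
  have hp0 : 0 < p := zero_lt_one.trans hp
  have hp1 : 1 ≤ ENNReal.ofReal p := by simpa using hp.le
  obtain ⟨φ, hφ, hgrad⟩ := hu.approx
  have hφm := fun k => (φ k).continuous.aestronglyMeasurable (μ := volume.restrict (Ω : Set (RN N)))
  have hlim_norm := tendsto_eLpNorm_of_tendsto_eLpNorm_sub hp1 hφm hu.memLp.1 hφ
  have hlim_grad := tendsto_eLpNorm_of_tendsto_eLpNorm_sub hp1
    (fun k => (continuous_gradient_testFunction (φ k)).aestronglyMeasurable) hu.memLp_grad.1 hgrad
  have hfin : ENNReal.ofReal p * eLpNorm u (ENNReal.ofReal p) (volume.restrict Ω) ^ (p - 1) ≠ ⊤ :=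
    ENNReal.mul_ne_top ENNReal.ofReal_ne_top
      (ENNReal.rpow_ne_top_of_nonneg (sub_pos.2 hp).le hu.memLp.2.ne)
  have hlim := ENNReal.Tendsto.const_mul (a := (C : ENNReal)) (ENNReal.Tendsto.mul
    (ENNReal.Tendsto.const_mul (a := ENNReal.ofReal p) (hlim_norm.ennrpow_const (p - 1))
      (Or.inr ENNReal.ofReal_ne_top)) (Or.inr hu.memLp_grad.2.ne) hlim_grad (Or.inr hfin))
    (Or.inr ENNReal.coe_ne_top)
  rw [← ENNReal.le_rpow_inv_iff hp0]
  exact eLpNorm_le_of_tendsto_eLpNorm_sub (zero_lt_one.trans_le hp1).ne' hφm hu.memLp.1 hφ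
    (hlim.ennrpow_const p⁻¹) fun k =>
      (ENNReal.le_rpow_inv_iff hp0).2 (hC.eLpNorm_testFunction_rpow_le hp (φ k))

end WeakSolution

namespace IsFirstEigenpair

variable {N : ℕ} {Ω : Opens (RN N)} {p lam : ℝ} {u : RN N → ℝ} {κ C : NNReal}

theorem aemeasurable (h : IsFirstEigenpair p Ω lam u) :
    AEMeasurable u (volume.restrict Ω) := by
  obtain ⟨G, hu, -⟩ := h.isSolution
  exact hu.memLp.1.aemeasurable

theorem integral_abs_rpow (h : IsFirstEigenpair p Ω lam u) :
    ∫ x in (Ω : Set (RN N)), |u x| ^ p = 1 := by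
  rw [← h.normalized]
  exact integral_congr_ae (h.pos.mono fun x hx => by simp only [abs_of_pos hx])

theorem exists_memW01p (h : IsFirstEigenpair p Ω lam u) (hp : 1 < p) :
    ∃ G, MemW01p p Ω u G ∧ ∫ x in (Ω : Set (RN N)), ‖G x‖ ^ p = lam := by
  simpa only [h.integral_abs_rpow, mul_one] using
    h.isSolution.exists_memW01p_integral_norm_rpow_eq hp

theorem nonneg (h : IsFirstEigenpair p Ω lam u) (hp : 1 < p) : 0 ≤ lam := by
  obtain ⟨G, -, hG⟩ := h.exists_memW01p hp
  exact hG ▸ integral_nonneg fun x => by positivity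

theorem eLpNorm_eq_one (h : IsFirstEigenpair p Ω lam u) (hp : 1 < p) :
    eLpNorm u (ENNReal.ofReal p) (volume.restrict Ω) = 1 := by
  have hp0 := zero_lt_one.trans hp
  obtain ⟨G, hu, -⟩ := h.exists_memW01p hp
  simp [hu.memLp.eLpNorm_eq_integral_rpow_norm (by simpa using hp0) ENNReal.ofReal_ne_top,
    ENNReal.toReal_ofReal hp0.le, h.integral_abs_rpow]

theorem lintegral_enorm_rpow_eq_one (h : IsFirstEigenpair p Ω lam u) (hp : 1 < p) :
    ∫⁻ x in (Ω : Set (RN N)), ‖u x‖ₑ ^ p = 1 := by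
  have hp0 := zero_lt_one.trans hp
  rw [lintegral_rpow_enorm_eq_rpow_eLpNorm' hp0, ← ENNReal.toReal_ofReal hp0.le,
    ← eLpNorm_eq_eLpNorm' (by simpa using hp0) ENNReal.ofReal_ne_top, h.eLpNorm_eq_one hp,
    ENNReal.one_rpow]

theorem eLpNorm_rpow_le (h : IsFirstEigenpair p Ω lam u)
    (hC : HasSobolevInequality (Ω : Set (RN N)) κ C) (hp : 1 < p) :
    eLpNorm u (κ * ENNReal.ofReal p) (volume.restrict Ω) ^ p ≤
      ENNReal.ofReal (C * (p * lam ^ (1 / p))) := by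
  have hp0 := zero_lt_one.trans hp
  obtain ⟨G, hu, hG⟩ := h.exists_memW01p hp
  have hGnorm : eLpNorm G (ENNReal.ofReal p) (volume.restrict Ω) =
      ENNReal.ofReal (lam ^ (1 / p)) := by
    rw [hu.memLp_grad.eLpNorm_eq_integral_rpow_norm (by simpa using hp0) ENNReal.ofReal_ne_top,
      ENNReal.toReal_ofReal hp0.le, hG, one_div]
  rw [ENNReal.ofReal_mul C.coe_nonneg, ENNReal.ofReal_coe_nnreal, ENNReal.ofReal_mul hp0.le]
  simpa only [h.eLpNorm_eq_one hp, ENNReal.one_rpow, mul_one, hGnorm] using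
    hu.eLpNorm_rpow_le hC hp

theorem lintegral_enorm_rpow_mul_le (h : IsFirstEigenpair p Ω lam u) (hκ : 0 < κ)
    (hC : HasSobolevInequality (Ω : Set (RN N)) κ C) (hp : 1 < p) :
    ∫⁻ x in (Ω : Set (RN N)), ‖u x‖ₑ ^ (p * κ) ≤
      ENNReal.ofReal (C * (p * lam ^ (1 / p))) ^ (κ : ℝ) := by
  have hp0 := zero_lt_one.trans hp
  have hexp : (κ * ENNReal.ofReal p).toReal = p * κ := by
    simp [ENNReal.toReal_ofReal hp0.le, mul_comm]
  rw [lintegral_rpow_enorm_eq_rpow_eLpNorm' (by positivity), ← hexp, ← eLpNorm_eq_eLpNorm'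
    (by positivity) (by finiteness), hexp, ENNReal.rpow_mul]
  exact ENNReal.rpow_le_rpow (h.eLpNorm_rpow_le hC hp) κ.coe_nonneg

theorem integral_rpow_nonneg (h : IsFirstEigenpair p Ω lam u) (q : ℝ) :
    0 ≤ ∫ x in (Ω : Set (RN N)), u x ^ q :=
  integral_nonneg_of_ae (h.pos.mono fun _ hx => Real.rpow_nonneg hx.le q)

theorem integral_rpow_eq_toReal_lintegral (h : IsFirstEigenpair p Ω lam u) {q : ℝ} (hq : 0 ≤ q) :
    ∫ x in (Ω : Set (RN N)), u x ^ q =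
      (∫⁻ x in (Ω : Set (RN N)), ‖u x‖ₑ ^ q).toReal := by
  rw [integral_eq_lintegral_of_nonneg_ae (h.pos.mono fun _ hx => Real.rpow_nonneg hx.le q)
    (h.aemeasurable.pow_const q).aestronglyMeasurable]
  refine congrArg _ (lintegral_congr_ae (h.pos.mono fun x hx => ?_))
  simp only [Real.enorm_eq_ofReal hx.le, ENNReal.ofReal_rpow_of_nonneg hx.le hq]

theorem lintegral_enorm_rpow_sub_one_rpow_le (h : IsFirstEigenpair p Ω lam u) (hp : 1 < p) :
    (∫⁻ x in (Ω : Set (RN N)), ‖u x‖ₑ ^ (p - 1)) ^ p ≤ volume (Ω : Set (RN N)) := by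
  simpa [h.lintegral_enorm_rpow_eq_one hp] using
    lintegral_rpow_le_lintegral_rpow_mul_lintegral_rpow h.aemeasurable.enorm le_rfl
      (sub_pos.2 hp) (sub_one_lt p)

theorem integral_rpow_sub_one_le (h : IsFirstEigenpair p Ω lam u) (hp : 1 < p)
    (hΩ : volume (Ω : Set (RN N)) ≠ ⊤) :
    ∫ x in (Ω : Set (RN N)), u x ^ (p - 1) ≤ volume.real (Ω : Set (RN N)) ^ (1 / p) := by
  have hp0 := zero_lt_one.trans hp
  rw [h.integral_rpow_eq_toReal_lintegral (sub_pos.2 hp).le, one_div,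
    Real.le_rpow_inv_iff_of_pos ENNReal.toReal_nonneg measureReal_nonneg hp0, ENNReal.toReal_rpow]
  exact ENNReal.toReal_mono hΩ (h.lintegral_enorm_rpow_sub_one_rpow_le hp)

theorem one_le_integral_rpow_sub_one_rpow_mul (h : IsFirstEigenpair p Ω lam u) (hp : 1 < p)
    (hΩ : volume (Ω : Set (RN N)) ≠ ⊤) (hκ : 1 < κ)
    (hC : HasSobolevInequality (Ω : Set (RN N)) κ C) :
    1 ≤ (∫ x in (Ω : Set (RN N)), u x ^ (p - 1)) ^ (κ - 1 : ℝ) *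
      (C * (p * lam ^ (1 / p))) ^ (κ / p : ℝ) := by
  have hp0 := zero_lt_one.trans hp
  have hκ1 : (1 : ℝ) < κ := by exact_mod_cast hκ
  have hlam := h.nonneg hp
  have hfin : ∫⁻ x in (Ω : Set (RN N)), ‖u x‖ₑ ^ (p - 1) ≠ ⊤ := fun htop => by
    simpa [htop, hp0, hΩ] using h.lintegral_enorm_rpow_sub_one_rpow_le hp
  have hinterp := lintegral_rpow_le_lintegral_rpow_mul_lintegral_rpow h.aemeasurable.enorm
    (sub_pos.2 hp).le (sub_one_lt p) (lt_mul_of_one_lt_right hp0 hκ1)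
  rw [h.lintegral_enorm_rpow_eq_one hp, ENNReal.one_rpow, sub_sub_cancel, ENNReal.rpow_one,
    ← mul_sub_one] at hinterp
  have hle := ENNReal.toReal_mono (by finiteness) (hinterp.trans
    (mul_le_mul_right (h.lintegral_enorm_rpow_mul_le (zero_lt_one.trans hκ) hC hp) _))
  rw [ENNReal.toReal_one, ENNReal.toReal_mul, ← ENNReal.toReal_rpow, ← ENNReal.toReal_rpow,
    ENNReal.toReal_ofReal (by positivity),
    ← h.integral_rpow_eq_toReal_lintegral (sub_pos.2 hp).le] at hle
  have hI := h.integral_rpow_nonneg (p - 1)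
  rw [← Real.rpow_le_rpow_iff zero_le_one (by positivity) hp0, Real.one_rpow,
    Real.mul_rpow (by positivity) (by positivity), ← Real.rpow_mul hI,
    ← Real.rpow_mul (by positivity), div_mul_cancel₀ _ hp0.ne', mul_comm _ p]
  exact hle

end IsFirstEigenpair

theorem tendsto_const_rpow_div_atTop {a : ℝ} (ha : 0 < a) (b : ℝ) :
    Tendsto (fun x : ℝ => a ^ (b / x)) atTop (𝓝 1) := by
  simpa only [Real.rpow_zero, Function.comp_def, id_eq] using
    (Real.continuous_const_rpow ha.ne').continuousAt.tendsto.comp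
      (tendsto_const_nhds.div_atTop tendsto_id)

theorem tendsto_mul_rpow_div_atTop {a : ℝ} (ha : 0 < a) (b : ℝ) :
    Tendsto (fun x : ℝ => (a * x) ^ (b / x)) atTop (𝓝 1) := by
  have hprod := (tendsto_const_rpow_div_atTop ha b).mul
    (tendsto_rpow_div_mul_add b 1 0 zero_ne_one)
  rw [mul_one] at hprod
  refine hprod.congr' ((eventually_ge_atTop 0).mono fun x hx => ?_)
  simp only [Real.mul_rpow ha.le hx, one_mul, add_zero]

namespace IsLimitAsPToInfty

variable {N : ℕ} {Ω : Opens (RN N)} {f : Measure (RN N)} {Λ : ℝ}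

theorem nonneg (hlim : IsLimitAsPToInfty Ω f Λ) : 0 ≤ Λ := by
  obtain ⟨-, -, p, lam, u, -, hp, hpair, hlam, -⟩ := hlim
  refine ge_of_tendsto hlam ((hp.eventually_gt_atTop 1).mono fun n hn => ?_)
  exact Real.rpow_nonneg ((hpair n).nonneg hn) _

theorem exists_tendsto_integral_rpow_sub_one (hlim : IsLimitAsPToInfty Ω f Λ) :
    ∃ (p lam : ℕ → ℝ) (u : ℕ → RN N → ℝ), Tendsto p atTop atTop ∧
      (∀ n, IsFirstEigenpair (p n) Ω (lam n) (u n)) ∧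
      (∀ᶠ n in atTop, lam n ^ (1 / p n) ≤ Λ + 1) ∧
      Tendsto (fun n => ∫ x in (Ω : Set (RN N)), u n x ^ (p n - 1)) atTop
        (𝓝 (f.real Set.univ)) := by
  obtain ⟨-, -, p, lam, u, -, hp, hpair, hlam, hconv⟩ := hlim
  refine ⟨p, lam, u, hp, hpair, hlam.eventually_le_const (lt_add_one Λ), ?_⟩
  simpa using hconv (BoundedContinuousFunction.const _ 1)

theorem measureReal_univ_le_one (hlim : IsLimitAsPToInfty Ω f Λ)
    (hΩ : volume (Ω : Set (RN N)) ≠ ⊤) : f.real Set.univ ≤ 1 := by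
  obtain ⟨p, lam, u, hp, hpair, -, hI⟩ := hlim.exists_tendsto_integral_rpow_sub_one
  have hroot := (tendsto_const_rpow_div_atTop
    (a := volume.real (Ω : Set (RN N)) + 1) (by positivity) 1).comp hp
  refine le_of_tendsto_of_tendsto hI hroot ((hp.eventually_gt_atTop 1).mono fun n hn => ?_)
  have : 0 < p n := zero_lt_one.trans hn
  exact ((hpair n).integral_rpow_sub_one_le hn hΩ).trans
    (Real.rpow_le_rpow measureReal_nonneg (lt_add_one _).le (by positivity))

theorem one_le_measureReal_univ (hlim : IsLimitAsPToInfty Ω f Λ)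
    (hΩ : volume (Ω : Set (RN N)) ≠ ⊤) {κ C : NNReal} (hκ : 1 < κ)
    (hC : HasSobolevInequality (Ω : Set (RN N)) κ C) : 1 ≤ f.real Set.univ := by
  have hΛ := hlim.nonneg
  have hκ1 : (0 : ℝ) < κ - 1 := sub_pos.2 (by exact_mod_cast hκ)
  obtain ⟨p, lam, u, hp, hpair, hlam, hI⟩ := hlim.exists_tendsto_integral_rpow_sub_one
  have hbound := (hI.rpow_const (Or.inr hκ1.le)).mul ((tendsto_mul_rpow_div_atTop
    (a := (C + 1) * (Λ + 1)) (by positivity) κ).comp hp)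
  rw [mul_one] at hbound
  have hone : 1 ≤ f.real Set.univ ^ (κ - 1 : ℝ) := by
    refine ge_of_tendsto hbound ?_
    filter_upwards [hp.eventually_gt_atTop 1, hlam] with n hn hlamn
    have : 0 < p n := zero_lt_one.trans hn
    have hlam0 := (hpair n).nonneg hn
    refine ((hpair n).one_le_integral_rpow_sub_one_rpow_mul hn hΩ hκ hC).trans ?_
    have hI0 := (hpair n).integral_rpow_nonneg (p n - 1)
    have hle : C * (p n * lam n ^ (1 / p n)) ≤ (C + 1) * (Λ + 1) * p n := by
      rw [mul_assoc _ (Λ + 1), mul_comm (p n)]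
      gcongr
      exact le_add_of_nonneg_right zero_le_one
    simp only [Function.comp_apply]
    gcongr
  exact le_of_not_gt fun hlt => hone.not_gt (Real.rpow_lt_one measureReal_nonneg hlt hκ1)

theorem isProbabilityMeasure (hlim : IsLimitAsPToInfty Ω f Λ) (hN : 0 < N)
    (hΩ : Bornology.IsBounded (Ω : Set (RN N))) : IsProbabilityMeasure f := by
  obtain ⟨κ, C, hκ, hC⟩ := exists_hasSobolevInequality (by simpa using hN) hΩ
  have hvol : volume (Ω : Set (RN N)) ≠ ⊤ := hΩ.measure_lt_top.ne
  exact isProbabilityMeasure_iff_real.2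
    ((hlim.measureReal_univ_le_one hvol).antisymm (hlim.one_le_measureReal_univ hvol hκ hC))

end IsLimitAsPToInfty

theorem mainTheorem6_general {N : ℕ} (hN : 0 < N) {Ω : Opens (RN N)}
    (hΩ : Bornology.IsBounded (Ω : Set (RN N))) {f : Measure (RN N)} [IsProbabilityMeasure f]
    (hf : f (closure (Ω : Set (RN N)))ᶜ = 0) {Λ : ℝ} (hΛ : 0 ≤ Λ) :
    ∃ m : ℝ,
      IsLeast (primalValues Ω f Λ) (-m) ∧
      (∀ ν : Measure (RN N), IsBoundaryProbability Ω ν → ∃ mν : ℝ, IsLeast (dualValues f Λ ν) mν) ∧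
      IsLeast (dualMinima Ω f Λ) m ∧
      IsLeast (dualSupportedValues Ω f Λ) m := by
  have : Nonempty (Fin N) := ⟨⟨0, hN⟩⟩
  have hΩ' : (Ω : Set (RN N)) ≠ Set.univ := fun h =>
    NormedSpace.unbounded_univ ℝ (RN N) (h ▸ hΩ)
  refine ⟨Λ * ∫ x, Metric.infDist x (Ω : Set (RN N))ᶜ ∂f, isLeast_primalValues hΩ hΩ' hf hΛ,
    fun ν hν => ?_, isLeast_dualMinima hΩ hΩ' hf hΛ, isLeast_dualSupportedValues hΩ hΩ' hf hΛ⟩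
  have := hν.1
  exact exists_isLeast_dualValues hΩ.closure hf
    (measure_mono_null (Set.compl_subset_compl.2 frontier_subset_closure) hν.2) hΛ

theorem mainTheorem6 {N : ℕ} (hN : 0 < N) (Ω : Opens (RN N))
    (hΩ : Bornology.IsBounded (Ω : Set (RN N)))
    (f : Measure (RN N)) (Λ : ℝ) (hlim : IsLimitAsPToInfty Ω f Λ) :
    ∃ m : ℝ,
      IsLeast (primalValues Ω f Λ) (-m) ∧
      (∀ ν : Measure (RN N), IsBoundaryProbability Ω ν → ∃ mν : ℝ, IsLeast (dualValues f Λ ν) mν) ∧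
      IsLeast (dualMinima Ω f Λ) m ∧
      IsLeast (dualSupportedValues Ω f Λ) m := by
  have := hlim.isProbabilityMeasure hN hΩ
  exact mainTheorem6_general hN hΩ hlim.2.1 hlim.nonneg
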